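/- **Setting.** Let $\mathfrak B=L^2_{1/2}(S^1;\mathbb C^n)$ be the real Hilbert space of loops $\gamma(\theta)=\sum_k c_ke^{ik\theta}$, $\|\gamma\|^2=|c_0|^2+\sum_k|k||c_k|^2$, and let $L^2_2(S^1;\mathbb C^n)\subset\mathfrak B$ carry $\|\gamma\|_{L^2_2}^2=|c_0|^2+\sum_k|k|^4|c_k|^2$. Let $H:\mathbb C^n\to\mathbb R$ be smooth, zero near $0$, and equal to $(1+\varepsilon)|x|^2$ for $|x|$ large, and let $$CSD_H(\gamma)=\int_0^{2\pi}\tfrac12\langle -J\dot\gamma,\gamma\rangle-H(\gamma(\theta))\,d\theta=\pi\sum_k k|c_k|^2-\int_0^{2\pi}H(\gamma(\theta))\,d\theta .$$ Polarize $\mathfrak B=T^+\oplus T^-$ by the spans of the eigenvectors of $-J\partial_\theta$ with positive and with nonpositive eigenvalues, or by the same two subspaces with the names $T^+$ and $T^-$ exchanged (the theorem holds for both labellings). $\Pi^\pm$ are the projections. *lc-manifolds.* An lc-manifold is a second countable Hausdorff space $P$ with closed subsets $P=P^0\supset P^1\supset\dots\supset P^{k+1}=\emptyset$ whose open strata $P^i\setminus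 P^{i+1}$ are smooth Hilbert manifolds, such that each point $p\in P^i\setminus P^{i+1}$ has an open neighbourhood $V$ in its open stratum and an lc-chart: a homeomorphism $f$ of some $V\times[0,\epsilon)^i$ onto an open subset of $P$ with $f(v,0)=v$ which respects the stratifications and is a diffeomorphism from each open stratum onto its image. Products are stratified by the sum of the two depths. A map $\sigma:P\to\mathfrak B$ is lc-smooth if it is continuous, smooth on open strata, and each point $p$ has an lc-chart as above in which $\sigma$ is smooth in the $V$-directions with $V$-derivative continuous on $V\times[0,\epsilon)^i$. $D\sigma_p$ denotes the differential along the open stratum containing $p$. *Chains.* A (semi-infinite) chain is an lc-smooth map $\sigma:P\to\mathfrak B$ from an lc-manifold such that: (1) $CSD_H$ is bounded below on $\operatorname{im}\sigma$ and, along $\operatorname{im}\sigma$, weakly lower semicontinuous at all weak limit points: for every $y\in\mathfrak B$ and $c<CSD_H(y)$ there is a weak neighbourhood $U$ of $y$ with $CSD_H>c$ on $U\cap\operatorname{im}\sigma$; (2) if $\sigma(x_i)$ converges weakly to $y\in\mathfrak B$ and $CSD_H(\sigma(x_i))\to CSD_H(y)$, then a subsequence of $x_i$ converges in $P$; (3)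 every subset of $\operatorname{im}\sigma$ on which $CSD_H$ is bounded is weakly relatively compact; (4) for each $p\in P$, $\Pi^-\circ D\sigma_p$ is Fredholm and $\Pi^+\circ D\sigma_p$ is compact. *Perturbation.* Let $\rho:\mathbb R\to\mathbb R$ be smooth and positive, $\rho=1$ on $[-1,1]$ and $\rho(x)=1/x^2$ outside $[-2,2]$. Let $\mathcal P$ be the (closed) unit ball of $L^2_2(S^1;\mathbb C^n)$, and for a chain $\sigma:P\to\mathfrak B$ and $x\in P$, $v\in L^2_2(S^1;\mathbb C^n)$ put $$F(x,v)=\sigma(x)+\rho\big(\|\sigma(x)\|^2_{L^2_{1/2}}\big)\,v .$$ **Theorem.** Let $\sigma:P\to\mathfrak B$ be a chain. Then $F$ is continuous on $P\times L^2_2$ and smooth on the product of each open stratum of $P$ with $L^2_2$, and: 1. $F(x,0)=\sigma(x)$ for all $x\in P$. 2. For all $(x,v)\in P\times\mathcal P$ the differential $DF_{(x,v)}$ (along the open stratum through $x$, and $L^2_2$) has dense image in $\mathfrak B$. 3. For all $(x,v)\in P\times\mathcal P$, $\Pi^-\circ D_xF$ is Fredholm, $\Pi^+\circ D_xF$ is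 compact, and $D_vF:L^2_2(S^1;\mathbb C^n)\to\mathfrak B$ is compact. 4. If $K$ is a compact lc-manifold and $\iota:K\to\mathfrak B$ is an lc-smooth map with values in $\mathcal P$ (for instance the inclusion of a compact lc-manifold $K\subset\mathcal P$), then $P\times K\to\mathfrak B$, $(x,k)\mapsto F(x,\iota(k))$, is again a semi-infinite chain; in particular $P\times K$ is an lc-manifold. -/

import Mathlib

open Set Filter Topology MeasureTheory
open scoped ContDiff

noncomputable section

universe u v

/-! ### Stratified Hilbert manifolds and locally cubical (lc) manifolds -/

/-- A chart of a space `P` with values in a real Hilbert space `Model`: a bijection between a subset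
`source` of `P` and a subset `target` of `Model`.  (The topological conditions are imposed in
`LCStructure.IsLCManifold`.) -/
structure HilbertChart (P : Type u) where
  /-- the model Hilbert space -/
  Model : Type
  [instNormed : NormedAddCommGroup Model]
  [instInner : InnerProductSpace ℝ Model]
  [instComplete : CompleteSpace Model]
  /-- the underlying partial bijection -/
  toPartialEquiv : PartialEquiv P Model

attribute [instance] HilbertChart.instNormed HilbertChart.instInner HilbertChart.instComplete

namespace HilbertChart

variable {P : Type u} {K : Type v}

/-- The domain of a chart. -/
def source (φ : HilbertChart P) : Set P := φ.toPartialEquiv.source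

/-- The image of a chart. -/
def target (φ : HilbertChart P) : Set φ.Model := φ.toPartialEquiv.target

/-- The coordinate map. -/
def coord (φ : HilbertChart P) : P → φ.Model := φ.toPartialEquiv

/-- The inverse of the coordinate map. -/
def param (φ : HilbertChart P) : φ.Model → P := φ.toPartialEquiv.symm

/-- The product of two charts, with values in the Hilbert space direct sum. -/
def prod (φ : HilbertChart P) (ψ : HilbertChart K) : HilbertChart (P × K) where
  Model := WithLp 2 (φ.Model × ψ.Model)
  toPartialEquiv := (φ.toPartialEquiv.prod ψ.toPartialEquiv).trans
    (WithLp.equiv 2 (φ.Model × ψ.Model)).symm.toPartialEquiv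

/-- The differential at `p` of a map `σ : P → B`, in the chart `φ`; the model space of `φ` represents
the tangent space at `p` of the open stratum on which `p` lives. -/
def D {B : Type*} [NormedAddCommGroup B] [NormedSpace ℝ B]
    (φ : HilbertChart P) (σ : P → B) (p : P) : φ.Model →L[ℝ] B :=
  fderiv ℝ (fun e => σ (φ.param e)) (φ.coord p)

end HilbertChart

/-- The data of a stratified space: `codim p` is the depth of the open stratum on which `p` lives,
so that `P^i = {p | i ≤ codim p}`, and `atlas` is a family of charts of the open strata
`P^i - P^{i+1} = {p | codim p = i}`. -/
structure LCStructure (P : Type u) where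
  /-- the index of the open stratum that contains a point -/
  codim : P → ℕ
  /-- charts of the open strata -/
  atlas : Set (HilbertChart P)

/-- The cube `[0, ε)^i`. -/
def cube (i : ℕ) (ε : ℝ) : Set (Fin i → ℝ) := {t | ∀ j, 0 ≤ t j ∧ t j < ε}

namespace LCStructure

variable {P : Type u} {K : Type v}

/-- `f : V × [0, ε)^i → P` is an lc-chart about the open subset `φ.param '' V` of the `i`-th open
stratum, where the latter is written in the chart `φ`: a homeomorphism onto an open subset of `P`
which is the identity on `V × 0`, respects the stratifications, and is a diffeomorphism from each
open stratum onto its image.  (A set `ψ.source` lies in a single open stratum, so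
the sets on which smoothness is required lie in single open strata as well.) -/
structure IsLCChart [TopologicalSpace P] (S : LCStructure P) (φ : HilbertChart P) (i : ℕ)
    (V : Set φ.Model) (ε : ℝ) (f : PartialEquiv (φ.Model × (Fin i → ℝ)) P) : Prop where
  mem_atlas : φ ∈ S.atlas
  isOpen_base : IsOpen V
  base_subset : V ⊆ φ.target
  pos : 0 < ε
  source_eq : f.source = V ×ˢ cube i ε
  isOpen_target : IsOpen f.target
  continuousOn : ContinuousOn f f.source
  continuousOn_symm : ContinuousOn f.symm f.target
  zero_section : ∀ v ∈ V, f (v, 0) = φ.param v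
  stratum : ∀ x ∈ f.source, S.codim (f x) = Nat.card {j : Fin i // x.2 j = 0}
  smooth : ∀ ψ ∈ S.atlas, ContDiffOn ℝ ∞ (fun x => ψ.coord (f x)) (f.source ∩ f ⁻¹' ψ.source)
  smooth_symm : ∀ ψ ∈ S.atlas,
    ContDiffOn ℝ ∞ (fun e => f.symm (ψ.param e)) (ψ.target ∩ ψ.param ⁻¹' f.target)

/-- The data `S` make `P` a locally cubical Hilbert manifold (lc-manifold) of finite depth. -/
structure IsLCManifold [TopologicalSpace P] (S : LCStructure P) : Prop where
  t2 : T2Space P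
  secondCountable : SecondCountableTopology P
  isClosed_stratum : ∀ i, IsClosed {p | i ≤ S.codim p}
  finite_depth : ∃ k, ∀ p, S.codim p ≤ k
  /- each open stratum is a smooth Hilbert manifold -/
  source_open : ∀ φ ∈ S.atlas, ∃ i, ∃ O : Set P, IsOpen O ∧ φ.source = O ∩ {p | S.codim p = i}
  target_open : ∀ φ ∈ S.atlas, IsOpen φ.target
  continuousOn_coord : ∀ φ ∈ S.atlas, ContinuousOn φ.coord φ.source
  continuousOn_param : ∀ φ ∈ S.atlas, ContinuousOn φ.param φ.target
  cover : ∀ p, ∃ φ ∈ S.atlas, p ∈ φ.source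
  compatible : ∀ φ ∈ S.atlas, ∀ ψ ∈ S.atlas,
    ContDiffOn ℝ ∞ (fun e => ψ.coord (φ.param e)) (φ.target ∩ φ.param ⁻¹' ψ.source)
  /- there are lc-charts about all points -/
  exists_lcChart : ∀ p, ∃ (φ : HilbertChart P) (V : Set φ.Model) (ε : ℝ)
    (f : PartialEquiv (φ.Model × (Fin (S.codim p) → ℝ)) P),
    S.IsLCChart φ (S.codim p) V ε f ∧ p ∈ φ.source ∧ φ.coord p ∈ V

/-- The product structure: `codim` is additive, and the charts are the products of charts. -/
def prod (S : LCStructure P) (T : LCStructure K) : LCStructure (P × K) where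
  codim := fun x => S.codim x.1 + T.codim x.2
  atlas := {χ | ∃ φ ∈ S.atlas, ∃ ψ ∈ T.atlas, χ = φ.prod ψ}

/-- `σ : P → B` is lc-smooth: it is continuous, smooth on each open stratum, and about each point
there is an lc-chart `V × [0, ε)^i` in which `σ` is smooth in the `V`-directions, with a derivative
in these directions that is continuous on `V × [0, ε)^i`. -/
structure IsLCSmooth [TopologicalSpace P] (S : LCStructure P) {B : Type*} [NormedAddCommGroup B]
    [NormedSpace ℝ B] (σ : P → B) : Prop where
  continuous : Continuous σ
  stratum_smooth : ∀ φ ∈ S.atlas, ContDiffOn ℝ ∞ (fun e => σ (φ.param e)) φ.target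
  exists_lcChart : ∀ p, ∃ (φ : HilbertChart P) (V : Set φ.Model) (ε : ℝ)
    (f : PartialEquiv (φ.Model × (Fin (S.codim p) → ℝ)) P),
    S.IsLCChart φ (S.codim p) V ε f ∧ p ∈ φ.source ∧ φ.coord p ∈ V ∧
    (∀ t ∈ cube (S.codim p) ε, ContDiffOn ℝ ∞ (fun v => σ (f (v, t))) V) ∧
    ContinuousOn (fun x : φ.Model × (Fin (S.codim p) → ℝ) =>
      fderiv ℝ (fun v => σ (f (v, x.2))) x.1) (V ×ˢ cube (S.codim p) ε)

end LCStructure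

/-! ### Polarizations and chains -/

/-- A (constant) polarization of a Hilbert space `B`: a decomposition `B = T⁺ ⊕ T⁻` as a
topological direct sum of closed subspaces. -/
structure Polarization (B : Type*) [NormedAddCommGroup B] [InnerProductSpace ℝ B] where
  /-- the subspace `T⁺` -/
  pos : Submodule ℝ B
  /-- the subspace `T⁻` -/
  neg : Submodule ℝ B
  isTopCompl : Submodule.IsTopCompl pos neg

namespace Polarization

variable {B : Type*} [NormedAddCommGroup B] [InnerProductSpace ℝ B]

/-- The projection `Π⁺` onto `T⁺` along `T⁻`. -/
def projPos (pol : Polarization B) : B →L[ℝ] pol.pos :=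
  pol.pos.projectionOntoL pol.neg pol.isTopCompl

/-- The projection `Π⁻` onto `T⁻` along `T⁺`. -/
def projNeg (pol : Polarization B) : B →L[ℝ] pol.neg :=
  pol.neg.projectionOntoL pol.pos pol.isTopCompl.symm

/-- The opposite polarization: the roles of `T⁺` and `T⁻` are exchanged. -/
def swap (pol : Polarization B) : Polarization B where
  pos := pol.neg
  neg := pol.pos
  isTopCompl := pol.isTopCompl.symm

end Polarization

/-- `σ : P → B` is a (semi-infinite) chain for the polarization `pol` and the functional `CSD`. -/
structure IsSemiInfiniteChain {P : Type u} [TopologicalSpace P] (S : LCStructure P)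
    {B : Type v} [NormedAddCommGroup B] [InnerProductSpace ℝ B] [CompleteSpace B]
    (pol : Polarization B) (CSD : B → ℝ) (σ : P → B) : Prop where
  isLCManifold : S.IsLCManifold
  isLCSmooth : S.IsLCSmooth σ
  /-- `CSD` is bounded below on the image of `σ`. -/
  bddBelow : BddBelow (CSD '' range σ)
  /-- Along the image of `σ`, the functional `CSD` is weakly lower
  semi-continuous at every weak limit point `w`, so that `CSD` can only drop in a weak limit. -/
  weak_lsc : ∀ w : WeakSpace ℝ B,
    LowerSemicontinuousWithinAt (fun z : WeakSpace ℝ B => CSD ((toWeakSpace ℝ B).symm z))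
      (toWeakSpace ℝ B '' range σ) w
  /-- If `σ (x i)` converges weakly to `y` and `CSD` converges to its value at `y`, then a subsequence
  of `x i` converges in `P`. -/
  strong_convergence : ∀ (x : ℕ → P) (y : B),
    Tendsto (fun i => toWeakSpace ℝ B (σ (x i))) atTop (𝓝 (toWeakSpace ℝ B y)) →
    Tendsto (fun i => CSD (σ (x i))) atTop (𝓝 (CSD y)) →
    ∃ (p : P) (k : ℕ → ℕ), StrictMono k ∧ Tendsto (fun i => x (k i)) atTop (𝓝 p)
  /-- Subsets of the image on which `CSD` is bounded are relatively compact in the weak topology. -/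
  weakly_precompact : ∀ A : Set B, A ⊆ range σ → (∃ C : ℝ, ∀ a ∈ A, |CSD a| ≤ C) →
    IsCompact (closure (toWeakSpace ℝ B '' A))
  /-- `Π⁻ ∘ Dσ_p` is Fredholm for each `p`. -/
  fredholm : ∀ φ ∈ S.atlas, ∀ p ∈ φ.source, (pol.projNeg ∘L φ.D σ p).IsFredholm
  /-- `Π⁺ ∘ Dσ_p` is compact for each `p`. -/
  compact : ∀ φ ∈ S.atlas, ∀ p ∈ φ.source, IsCompactOperator (pol.projPos ∘L φ.D σ p)

/-! ### Sobolev spaces of loops in `ℂⁿ` -/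

/-- The Hilbert space `L²_s(S¹; ℂⁿ)` of loops `γ(θ) = ∑ c_k e^{ikθ}`, with
`‖γ‖² = |c_0|² + ∑ |k|^{2s} |c_k|²`.  A loop is recorded by its square-summable sequence of
normalized coefficients `w_k c_k`, where `w_0 = 1` and `w_k = |k|^s` for `k ≠ 0`;
see `Loop.coeff` and `Loop.norm_sq`. -/
def Loop (_s : ℝ) (n : ℕ) : Type := lp (fun _ : ℤ => EuclideanSpace ℂ (Fin n)) 2

namespace Loop

variable {s t : ℝ} {n : ℕ}

instance : NormedAddCommGroup (Loop s n) :=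
  inferInstanceAs (NormedAddCommGroup (lp (fun _ : ℤ => EuclideanSpace ℂ (Fin n)) 2))

instance : InnerProductSpace ℝ (Loop s n) :=
  inferInstanceAs (InnerProductSpace ℝ (lp (fun _ : ℤ => EuclideanSpace ℂ (Fin n)) 2))

instance : CompleteSpace (Loop s n) :=
  inferInstanceAs (CompleteSpace (lp (fun _ : ℤ => EuclideanSpace ℂ (Fin n)) 2))

/-- The weight `w_k`: `1` for `k = 0` and `|k|^s` for `k ≠ 0`. -/
def weight (s : ℝ) (k : ℤ) : ℝ := if k = 0 then 1 else |(k : ℝ)| ^ s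

/-- The normalized coefficient `w_k c_k`. -/
def ncoeff (γ : Loop s n) (k : ℤ) : EuclideanSpace ℂ (Fin n) :=
  (show lp (fun _ : ℤ => EuclideanSpace ℂ (Fin n)) 2 from γ) k

/-- The Fourier coefficient `c_k` of the loop `γ(θ) = ∑ c_k e^{ikθ}`. -/
def coeff (γ : Loop s n) (k : ℤ) : EuclideanSpace ℂ (Fin n) := (weight s k)⁻¹ • γ.ncoeff k

theorem weight_pos (s : ℝ) (k : ℤ) : 0 < weight s k := by
  unfold weight
  split_ifs with h
  · exact one_pos
  · have : (k : ℝ) ≠ 0 := by exact_mod_cast h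
    positivity

theorem weight_mono {s t : ℝ} (h : s ≤ t) (k : ℤ) : weight s k ≤ weight t k := by
  unfold weight
  split_ifs with hk
  · exact le_rfl
  · apply Real.rpow_le_rpow_of_exponent_le _ h
    exact_mod_cast Int.one_le_abs hk

theorem one_le_weight {s : ℝ} (h : 0 ≤ s) (k : ℤ) : 1 ≤ weight s k := by
  have := weight_mono h k
  have h0 : weight 0 k = 1 := by simp [weight]
  linarith

theorem norm_sq (γ : Loop s n) : ‖γ‖ ^ 2 = ∑' k : ℤ, weight s k ^ 2 * ‖γ.coeff k‖ ^ 2 := by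
  have h := lp.norm_rpow_eq_tsum (p := 2) (by norm_num)
    (show lp (fun _ : ℤ => EuclideanSpace ℂ (Fin n)) 2 from γ)
  have e : ∀ k : ℤ, weight s k ^ 2 * ‖γ.coeff k‖ ^ 2 = ‖γ.ncoeff k‖ ^ 2 := by
    intro k
    have := weight_pos s k
    rw [coeff, norm_smul, Real.norm_of_nonneg (by positivity)]
    field_simp
  simp_rw [e]
  simp only [ENNReal.toReal_ofNat, Real.rpow_ofNat] at h
  exact h

theorem memlp_ncoeff (γ : Loop s n) : Memℓp γ.ncoeff 2 :=
  lp.memℓp (show lp (fun _ : ℤ => EuclideanSpace ℂ (Fin n)) 2 from γ)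

/-- The bounded operator that multiplies the `k`-th normalized coefficient by `m k`. -/
def multiplier (s t : ℝ) (n : ℕ) (m : ℤ → ℝ) (hm : ∀ k, |m k| ≤ 1) : Loop s n →L[ℝ] Loop t n :=
  LinearMap.mkContinuous
    { toFun := fun γ => (⟨fun k => m k • γ.ncoeff k, by
        refine γ.memlp_ncoeff.mono' fun k => ?_
        rw [norm_smul, Real.norm_eq_abs]
        exact mul_le_of_le_one_left (norm_nonneg _) (hm k)⟩ :
          lp (fun _ : ℤ => EuclideanSpace ℂ (Fin n)) 2)
      map_add' := fun a b => by
        apply lp.ext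
        funext k
        exact smul_add (m k) (a.ncoeff k) (b.ncoeff k)
      map_smul' := fun c a => by
        apply lp.ext
        funext k
        exact smul_comm (m k) c (a.ncoeff k) } 1
    (fun γ => by
      rw [one_mul]
      refine lp.norm_mono (p := 2) (by norm_num) fun k => ?_
      change ‖m k • γ.ncoeff k‖ ≤ ‖γ.ncoeff k‖
      rw [norm_smul, Real.norm_eq_abs]
      exact mul_le_of_le_one_left (norm_nonneg _) (hm k))

theorem ncoeff_multiplier (m : ℤ → ℝ) (hm : ∀ k, |m k| ≤ 1) (γ : Loop s n) (k : ℤ) :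
    (multiplier s t n m hm γ).ncoeff k = m k • γ.ncoeff k := rfl

theorem ncoeff_ext {γ δ : Loop s n} (h : ∀ k, γ.ncoeff k = δ.ncoeff k) : γ = δ :=
  lp.ext (funext h)

/-- The inclusion `L²_t ⊆ L²_s` for `s ≤ t`; it keeps the Fourier coefficients, see
`Loop.coeff_incl`. -/
def incl (n : ℕ) (h : s ≤ t) : Loop t n →L[ℝ] Loop s n :=
  multiplier t s n (fun k => weight s k / weight t k) fun k => by
    have h1 := weight_pos s k
    have h2 := weight_pos t k
    rw [abs_of_pos (by positivity), div_le_one h2]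
    exact weight_mono h k

theorem coeff_incl (h : s ≤ t) (γ : Loop t n) (k : ℤ) : (incl n h γ).coeff k = γ.coeff k := by
  have h1 := weight_pos s k
  have h2 := weight_pos t k
  rw [coeff, coeff, incl, ncoeff_multiplier, smul_smul]
  congr 1
  field_simp

end Loop

/-- The Hilbert space `𝔅 = L²_{1/2}(S¹; ℂⁿ)`. -/
abbrev LoopHalf (n : ℕ) : Type := Loop (1 / 2) n

/-- The Hilbert space `L²_2(S¹; ℂⁿ)`. -/
abbrev LoopTwo (n : ℕ) : Type := Loop 2 n

/-- The inclusion `L²_2(S¹; ℂⁿ) ⊆ L²_{1/2}(S¹; ℂⁿ)`. -/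
def inclTwo (n : ℕ) : LoopTwo n →L[ℝ] LoopHalf n := Loop.incl n (by norm_num)

instance twoPiPos : Fact (0 < 2 * Real.pi) := ⟨Real.two_pi_pos⟩

/-- The `j`-th component of a loop, as a sequence of scalar Fourier coefficients. -/
def LoopHalf.component {n : ℕ} (γ : LoopHalf n) (j : Fin n) : lp (fun _ : ℤ => ℂ) 2 :=
  ⟨fun k => γ.coeff k j, by
    refine γ.memlp_ncoeff.mono' fun k => (PiLp.norm_apply_le (γ.coeff k) j).trans ?_
    have h := Loop.one_le_weight (s := 1 / 2) (by norm_num) k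
    rw [Loop.coeff, norm_smul, Real.norm_of_nonneg (by positivity)]
    exact mul_le_of_le_one_left (norm_nonneg _) (inv_le_one_of_one_le₀ h)⟩

/-- The value `γ(θ) ∈ ℂⁿ` (for almost every `θ ∈ S¹ = ℝ/2πℤ`) of a loop `γ`: in each component it
is the sum in `L²(S¹)` of the Fourier series `∑ c_k e^{ikθ}`. -/
def LoopHalf.eval {n : ℕ} (γ : LoopHalf n) (θ : AddCircle (2 * Real.pi)) :
    EuclideanSpace ℂ (Fin n) :=
  WithLp.toLp 2 fun j => (fourierBasis (T := 2 * Real.pi)).repr.symm (γ.component j) θ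

/-- The action functional `CSD_H(γ) = ∫ ½⟨-J γ'(θ), γ(θ)⟩ - H(γ(θ)) dθ` on `L²_{1/2}(S¹; ℂⁿ)`,
with `J` the multiplication by `i`.  Since `-J ∂_θ (c e^{ikθ}) = k c e^{ikθ}`, the quadratic part
is `½ ∑ 2π k |c_k|²`, which is its meaning for loops of class `L²_{1/2}`. -/
def actionFunctional {n : ℕ} (H : EuclideanSpace ℂ (Fin n) → ℝ) (γ : LoopHalf n) : ℝ :=
  Real.pi * ∑' k : ℤ, (k : ℝ) * ‖γ.coeff k‖ ^ 2 - ∫ θ : AddCircle (2 * Real.pi), H (γ.eval θ)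

/-- The Hamiltonians under consideration: smooth, zero near the origin, and equal to
`(1 + ε)|x|²` for `|x|` large. -/
structure IsAdmissibleHamiltonian {n : ℕ} (H : EuclideanSpace ℂ (Fin n) → ℝ) : Prop where
  smooth : ContDiff ℝ ∞ H
  zero_near : ∀ᶠ x in 𝓝 0, H x = 0
  quadratic : ∃ ε R : ℝ, ∀ x, R ≤ ‖x‖ → H x = (1 + ε) * ‖x‖ ^ 2

/-- The spectral polarization of `𝔅 = L²_{1/2}(S¹; ℂⁿ)`: `T⁺` is spanned by the eigenvectors of
`-J ∂_θ` with positive eigenvalue, and `T⁻` by those with nonpositive eigenvalue. -/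
def spectralPolarization (n : ℕ) : Polarization (LoopHalf n) where
  pos :=
    { carrier := {γ | ∀ k : ℤ, k ≤ 0 → γ.coeff k = 0}
      add_mem' := fun {a b} ha hb k hk => by
        have h : (a + b).coeff k = a.coeff k + b.coeff k :=
          smul_add (Loop.weight (1 / 2) k)⁻¹ (a.ncoeff k) (b.ncoeff k)
        rw [h, ha k hk, hb k hk, add_zero]
      zero_mem' := fun k _ => smul_zero (Loop.weight (1 / 2) k)⁻¹
      smul_mem' := fun c a ha k hk => by
        have h : (c • a).coeff k = c • a.coeff k :=
          smul_comm (Loop.weight (1 / 2) k)⁻¹ c (a.ncoeff k)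
        rw [h, ha k hk, smul_zero] }
  neg :=
    { carrier := {γ | ∀ k : ℤ, 0 < k → γ.coeff k = 0}
      add_mem' := fun {a b} ha hb k hk => by
        have h : (a + b).coeff k = a.coeff k + b.coeff k :=
          smul_add (Loop.weight (1 / 2) k)⁻¹ (a.ncoeff k) (b.ncoeff k)
        rw [h, ha k hk, hb k hk, add_zero]
      zero_mem' := fun k _ => smul_zero (Loop.weight (1 / 2) k)⁻¹
      smul_mem' := fun c a ha k hk => by
        have h : (c • a).coeff k = c • a.coeff k :=
          smul_comm (Loop.weight (1 / 2) k)⁻¹ c (a.ncoeff k)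
        rw [h, ha k hk, smul_zero] }
  isTopCompl := by
    have hz : ∀ (γ : LoopHalf n) (k : ℤ), γ.coeff k = 0 ↔ γ.ncoeff k = 0 := fun γ k => by
      have := Loop.weight_pos (1 / 2) k
      rw [Loop.coeff, smul_eq_zero]
      exact or_iff_right (by positivity)
    let p : LoopHalf n →L[ℝ] LoopHalf n :=
      Loop.multiplier (1 / 2) (1 / 2) n (fun k => if 0 < k then 1 else 0)
        (fun k => by split_ifs <;> simp)
    have hp : IsIdempotentElem p := by
      ext1 γ
      apply Loop.ncoeff_ext
      intro k
      change (if 0 < k then (1 : ℝ) else 0) • ((if 0 < k then (1 : ℝ) else 0) • γ.ncoeff k) =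
        (if 0 < k then (1 : ℝ) else 0) • γ.ncoeff k
      split_ifs <;> simp
    convert ContinuousLinearMap.IsIdempotentElem.isTopCompl hp using 1
    · ext γ
      constructor
      · intro h
        refine ⟨γ, Loop.ncoeff_ext fun k => ?_⟩
        change (if 0 < k then (1 : ℝ) else 0) • γ.ncoeff k = γ.ncoeff k
        split_ifs with hk
        · simp
        · rw [zero_smul, (hz γ k).1 (h k (not_lt.1 hk))]
      · rintro ⟨δ, rfl⟩ k hk
        rw [hz]
        change (if 0 < k then (1 : ℝ) else 0) • δ.ncoeff k = 0
        rw [if_neg (not_lt.2 hk), zero_smul]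
    · ext γ
      constructor
      · intro h
        refine Loop.ncoeff_ext fun k => ?_
        change (if 0 < k then (1 : ℝ) else 0) • γ.ncoeff k = 0
        split_ifs with hk
        · rw [one_smul, (hz γ k).1 (h k hk)]
        · rw [zero_smul]
      · intro h k hk
        rw [hz]
        have h' : (p γ).ncoeff k = 0 := by
          rw [show p γ = 0 from h]
          rfl
        change (if 0 < k then (1 : ℝ) else 0) • γ.ncoeff k = 0 at h'
        rwa [if_pos hk, one_smul] at h'

/-! ### The perturbation -/

/-- The unit ball `𝒫 ⊆ 𝔅` in the `L²_2`-norm. -/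
def pertBall (n : ℕ) : Set (LoopHalf n) := inclTwo n '' Metric.closedBall 0 1

/-- A positive smooth bump function `ρ : ℝ → ℝ` that is `1` on `[-1, 1]` and `1 / x²` outside
`[-2, 2]`. -/
structure IsCutoff (ρ : ℝ → ℝ) : Prop where
  smooth : ContDiff ℝ ∞ ρ
  pos : ∀ x, 0 < ρ x
  eq_one : ∀ x ∈ Icc (-1 : ℝ) 1, ρ x = 1
  eq_inv_sq : ∀ x, x ∉ Icc (-2 : ℝ) 2 → ρ x = 1 / x ^ 2

/-- The perturbation `F(x, v) = σ(x) + ρ(‖σ(x)‖²) v`. -/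
def perturb {P : Type u} {n : ℕ} (ρ : ℝ → ℝ) (σ : P → LoopHalf n) (x : P) (v : LoopHalf n) :
    LoopHalf n :=
  σ x + ρ (‖σ x‖ ^ 2) • v

end

/-!
The perturbation `ρ(‖σ‖²) v` is small in every sense that the chain axioms can see.

*Differentials.* For fixed `v` the differential of `F(·, v)` is that of `σ` plus an operator of rank
one (`D_perturb`), and the parameters `v ∈ L²_2` enter through the compact inclusion of `L²_2` into
`L²_{1/2}`, multiplied by the positive number `ρ(‖σ(x)‖²)`.  So the Fredholm and compactness
properties persist, and the total differential has dense image because `L²_2` is dense.  A compact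
lc-manifold `K` has finite-dimensional strata (`LCStructure.IsLCManifold.finiteDimensional`), hence
only finitely many dimensions are added on `P × K`.

*Action.* The action is a bounded quadratic form, given by the operator `sign (-J ∂_θ)`, minus the
term `∫ H(γ)`, which is locally Lipschitz for the `L²`-norm since `H` differs from a multiple of
`|x|²` by a compactly supported function.  Therefore the action changes by at most
`C (1 + ‖γ‖ + ‖u‖) ‖u‖` when `u` is added to `γ`.  As `ρ(t²)` decays like `t⁻⁴`, the action changes by
a bounded amount under the perturbation, and by an amount that tends to zero as `‖σ‖ → ∞`
(`IsAdmissibleHamiltonian.exists_abs_perturb_sub_le`).  Moreover, if `x` converges weakly and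
stays bounded and `u` converges in norm, then the change of the action converges to its value at
the limits, by Rellich's theorem
(`IsAdmissibleHamiltonian.tendsto_actionFunctional_add_sub`).

*Weak limits.* Let `F(x, ι k)` converge weakly to `w` along an ultrafilter; ultrafilters are needed
because the image is unbounded, so that sequences do not detect weak neighbourhoods.  Either
`‖σ(x)‖` stays bounded, and after convergence of `k` in the compact space `K` and of `ρ(‖σ(x)‖²)` in
a compact interval, `σ(x)` converges weakly; or `‖σ(x)‖ → ∞`, the perturbation tends to zero in norm
and `σ(x)` converges weakly to `w` itself.  In both cases the change of the action converges to its
value at the limits (`exists_tendsto_of_ultrafilter`), which carries lower semicontinuity over from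
`σ` to `F`.  In the convergence axiom the weak limit is that of a sequence, which is bounded, so
only the first case occurs.  Relative compactness holds since `F` differs from `σ` by a point of the
compact set `[0, B] · ι(K)`.

*Products.* Products of lc-charts, on cubes of equal size, are lc-charts
(`LCStructure.IsLCChart.prod`), and a smooth function of two lc-smooth maps is lc-smooth
(`LCStructure.IsLCSmooth.comp_prod`).
-/

universe u v

/-! ### Fredholm operators, compact operators and weak convergence -/

section FredholmCompact

open scoped LinearMap.FiniteRangeSetoid

variable {E F G : Type*} [NormedAddCommGroup E] [NormedSpace ℝ E]
  [NormedAddCommGroup F] [NormedSpace ℝ F] [NormedAddCommGroup G] [NormedSpace ℝ G]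

theorem ContinuousLinearMap.IsFredholm.add_of_hasFiniteRange {u w : E →L[ℝ] F}
    (hu : u.IsFredholm) (hw : (w : E →ₗ[ℝ] F).HasFiniteRange) : (u + w).IsFredholm := by
  obtain ⟨v, hv⟩ := hu.exists_isQuasiInverse
  refine .of_isQuasiInverse (v := v) (hv.congr (u' := (v : F →ₗ[ℝ] E))
    (v' := (↑(u + w) : E →ₗ[ℝ] F)) (Setoid.refl _) ?_)
  rw [LinearMap.FiniteRangeSetoid.equiv_iff_hasFiniteRange]
  simpa using hw

theorem ContinuousLinearMap.IsFredholm.comp {u : E →L[ℝ] F} {w : F →L[ℝ] G}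
    (hw : w.IsFredholm) (hu : u.IsFredholm) : (w ∘L u).IsFredholm := by
  obtain ⟨v, hv⟩ := hu.exists_isQuasiInverse
  obtain ⟨z, hz⟩ := hw.exists_isQuasiInverse
  exact .of_isQuasiInverse (v := v ∘L z) (hv.comp hz)

/-- The projection of a product onto a factor is Fredholm if the other factor is
finite-dimensional: the inclusion of the factor is a quasi-inverse. -/
theorem ContinuousLinearMap.isFredholm_fst [FiniteDimensional ℝ F] :
    (ContinuousLinearMap.fst ℝ E F).IsFredholm := by
  refine .of_isQuasiInverse (v := ContinuousLinearMap.inl ℝ E F) ⟨?_, ?_⟩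
  · change _ ≈ _
    rw [LinearMap.FiniteRangeSetoid.equiv_iff_hasFiniteRange]
    have h : (ContinuousLinearMap.inl ℝ E F).toLinearMap ∘ₗ
        (ContinuousLinearMap.fst ℝ E F).toLinearMap - LinearMap.id =
        -((ContinuousLinearMap.inr ℝ E F).toLinearMap ∘ₗ
          (ContinuousLinearMap.snd ℝ E F).toLinearMap) :=
      LinearMap.ext fun x => Prod.ext (by simp) (by simp)
    rw [h]
    exact (LinearMap.HasFiniteRange.comp_right
      (v := (ContinuousLinearMap.inr ℝ E F).toLinearMap) .of_finite_dom _).neg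
  · change _ ≈ _
    rw [LinearMap.FiniteRangeSetoid.equiv_iff_hasFiniteRange]
    have h : (ContinuousLinearMap.fst ℝ E F).toLinearMap ∘ₗ
        (ContinuousLinearMap.inl ℝ E F).toLinearMap - LinearMap.id = 0 :=
      LinearMap.ext fun x => by simp
    rw [h]
    exact .zero

theorem ContinuousLinearEquiv.isFredholm (e : E ≃L[ℝ] F) : (e : E →L[ℝ] F).IsFredholm :=
  .of_isQuasiInverse (v := (e.symm : F →L[ℝ] E)) e.toLinearEquiv.isQuasiInverse

theorem LinearMap.HasFiniteRange.isCompactOperator {w : E →L[ℝ] F}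
    (hw : (w : E →ₗ[ℝ] F).HasFiniteRange) : IsCompactOperator w := by
  have : FiniteDimensional ℝ (LinearMap.range (w : E →ₗ[ℝ] F)) := .of_fg hw
  have := FiniteDimensional.proper ℝ (LinearMap.range (w : E →ₗ[ℝ] F))
  have h : IsCompactOperator (w.codRestrict (LinearMap.range (w : E →ₗ[ℝ] F))
      fun x => ⟨x, rfl⟩) :=
    isCompactOperator_of_locallyCompactSpace_dom _
  exact h.clm_comp (LinearMap.range (w : E →ₗ[ℝ] F)).subtypeL

theorem hasFiniteRange_smulRight (f : E →L[ℝ] ℝ) (v : F) :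
    ((f.smulRight v : E →L[ℝ] F) : E →ₗ[ℝ] F).HasFiniteRange := by
  have h : ((f.smulRight v : E →L[ℝ] F) : E →ₗ[ℝ] F) =
      (LinearMap.toSpanSingleton ℝ F v) ∘ₗ (f : E →ₗ[ℝ] ℝ) := by
    ext x; simp
  rw [h]
  exact LinearMap.HasFiniteRange.comp_right (v := LinearMap.toSpanSingleton ℝ F v) .of_finite_dom _

/-- The Fredholm property survives the addition of finitely many parameters. -/
theorem ContinuousLinearMap.IsFredholm.comp_prod {X Y : Type*} [NormedAddCommGroup X]
    [NormedSpace ℝ X] [NormedAddCommGroup Y] [NormedSpace ℝ Y] [FiniteDimensional ℝ F]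
    {π : G →L[ℝ] Y} {a : E →L[ℝ] G} (h : (π ∘L a).IsFredholm) (b : F →L[ℝ] G) (e : X ≃L[ℝ] E × F) :
    (π ∘L ((a ∘L ContinuousLinearMap.fst ℝ E F + b ∘L ContinuousLinearMap.snd ℝ E F) ∘L
      (e : X →L[ℝ] E × F))).IsFredholm := by
  rw [← ContinuousLinearMap.comp_assoc]
  refine ContinuousLinearMap.IsFredholm.comp ?_ e.isFredholm
  rw [ContinuousLinearMap.comp_add]
  exact (h.comp ContinuousLinearMap.isFredholm_fst).add_of_hasFiniteRange
    (LinearMap.HasFiniteRange.comp_right (v := (π ∘L b).toLinearMap) .of_finite_dom _)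

theorem IsCompactOperator.comp_prod {X Y : Type*} [NormedAddCommGroup X]
    [NormedSpace ℝ X] [NormedAddCommGroup Y] [NormedSpace ℝ Y] [FiniteDimensional ℝ F]
    {π : G →L[ℝ] Y} {a : E →L[ℝ] G} (h : IsCompactOperator (π ∘L a)) (b : F →L[ℝ] G)
    (e : X ≃L[ℝ] E × F) :
    IsCompactOperator (π ∘L ((a ∘L ContinuousLinearMap.fst ℝ E F +
      b ∘L ContinuousLinearMap.snd ℝ E F) ∘L (e : X →L[ℝ] E × F))) := by
  rw [← ContinuousLinearMap.comp_assoc, ContinuousLinearMap.comp_add]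
  refine IsCompactOperator.comp_clm (IsCompactOperator.add
    (f := π ∘L a ∘L ContinuousLinearMap.fst ℝ E F) (h.comp_clm (ContinuousLinearMap.fst ℝ E F))
    (LinearMap.HasFiniteRange.isCompactOperator ?_)) (e : X →L[ℝ] E × F)
  exact LinearMap.HasFiniteRange.comp_right (v := (π ∘L b).toLinearMap) .of_finite_dom _

/-- Weak convergence means convergence of all continuous functionals. -/
theorem tendsto_toWeakSpace_iff {α : Type*} {l : Filter α} {x : α → E} {y : E} :
    Tendsto (fun a => toWeakSpace ℝ E (x a)) l (𝓝 (toWeakSpace ℝ E y)) ↔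
      ∀ f : E →L[ℝ] ℝ, Tendsto (fun a => f (x a)) l (𝓝 (f y)) := by
  have hinj : Function.Injective (topDualPairing ℝ E).flip := by
    intro a b hab
    by_contra hne
    obtain ⟨f, hf⟩ := SeparatingDual.exists_separating_of_ne (R := ℝ) hne
    exact hf (congrArg (fun g : Module.Dual ℝ (E →L[ℝ] ℝ) => g f) hab)
  exact WeakBilin.tendsto_iff_forall_eval_tendsto _ hinj

theorem exists_norm_le_of_tendsto_toWeakSpace {x : ℕ → E} {y : E}
    (h : Tendsto (fun i => toWeakSpace ℝ E (x i)) atTop (𝓝 (toWeakSpace ℝ E y))) :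
    ∃ M, ∀ i, ‖x i‖ ≤ M := by
  rw [tendsto_toWeakSpace_iff] at h
  obtain ⟨M, hM⟩ := banach_steinhaus
    (g := fun i => NormedSpace.inclusionInDoubleDual ℝ E (x i)) (fun f => by
      obtain ⟨C, hC⟩ := (h f).norm.bddAbove_range
      exact ⟨C, fun i => hC ⟨i, rfl⟩⟩)
  refine ⟨M, fun i => ?_⟩
  have := hM i
  rwa [show ‖NormedSpace.inclusionInDoubleDual ℝ E (x i)‖ = ‖x i‖ from
    (NormedSpace.inclusionInDoubleDualLi ℝ (E := E)).norm_map (x i)] at this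

/-- A compact operator turns bounded weak convergence into norm convergence. -/
theorem IsCompactOperator.tendsto_of_tendsto_toWeakSpace {α : Type*} {l : Filter α}
    {T : E →L[ℝ] F} (hT : IsCompactOperator T) {x : α → E} {y : E} {M : ℝ}
    (hM : ∀ᶠ a in l, ‖x a‖ ≤ M)
    (h : Tendsto (fun a => toWeakSpace ℝ E (x a)) l (𝓝 (toWeakSpace ℝ E y))) :
    Tendsto (fun a => T (x a)) l (𝓝 (T y)) := by
  rw [tendsto_toWeakSpace_iff] at h
  obtain ⟨C, hC, hsub⟩ := IsCompactOperator.image_closedBall_subset_compact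
    (f := (T : E →ₗ[ℝ] F)) hT M
  rw [tendsto_iff_ultrafilter]
  intro g hg
  have hmem : ∀ᶠ a in (g : Filter α), T (x a) ∈ C := by
    filter_upwards [hg hM] with a ha
    exact hsub ⟨x a, by simpa using ha, rfl⟩
  obtain ⟨z, -, hz⟩ := hC.ultrafilter_le_nhds (g.map fun a => T (x a)) (le_principal_iff.2 hmem)
  have hz' : Tendsto (fun a => T (x a)) g (𝓝 z) := hz
  -- the norm limit agrees with the weak limit
  suffices z = T y by rwa [this] at hz'
  by_contra hne
  obtain ⟨f, hf⟩ := SeparatingDual.exists_separating_of_ne (R := ℝ) hne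
  exact hf (tendsto_nhds_unique ((f.continuous.tendsto z).comp hz') ((h (f ∘L T)).mono_left hg))

end FredholmCompact

/-! ### Operators on Sobolev spaces of loops -/

namespace Loop

variable {s t : ℝ} {n : ℕ}

/-- The `k`-th normalized coefficient, as a bounded operator. -/
noncomputable def ncoeffL (s : ℝ) (n : ℕ) (k : ℤ) : Loop s n →L[ℝ] EuclideanSpace ℂ (Fin n) :=
  lp.evalCLM ℝ (fun _ : ℤ => EuclideanSpace ℂ (Fin n)) 2 k

/-- The loop whose only nonzero normalized coefficient is the `k`-th. -/
noncomputable def singleL (s : ℝ) (n : ℕ) (k : ℤ) : EuclideanSpace ℂ (Fin n) →L[ℝ] Loop s n :=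
  lp.singleContinuousLinearMap ℝ (fun _ : ℤ => EuclideanSpace ℂ (Fin n)) 2 k

theorem ncoeff_singleL (k j : ℤ) (c : EuclideanSpace ℂ (Fin n)) :
    (singleL s n k c).ncoeff j = if j = k then c else 0 := by
  change (lp.single 2 k c : lp (fun _ : ℤ => EuclideanSpace ℂ (Fin n)) 2) j = _
  split_ifs with h
  · subst h; exact lp.single_apply_self (E := fun _ : ℤ => EuclideanSpace ℂ (Fin n)) 2 j c
  · exact lp.single_apply_ne (E := fun _ : ℤ => EuclideanSpace ℂ (Fin n)) 2 k c h

theorem ncoeff_sum {ι : Type*} (F : Finset ι) (g : ι → Loop s n) (k : ℤ) :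
    (∑ i ∈ F, g i).ncoeff k = ∑ i ∈ F, (g i).ncoeff k :=
  map_sum (ncoeffL s n k) g F

theorem norm_multiplier_le (m : ℤ → ℝ) (hm : ∀ k, |m k| ≤ 1) {c : ℝ} (hc : 0 ≤ c)
    (h : ∀ k, |m k| ≤ c) : ‖multiplier s t n m hm‖ ≤ c := by
  refine ContinuousLinearMap.opNorm_le_bound _ hc fun γ => ?_
  rw [show c * ‖γ‖ = ‖c • γ‖ by rw [norm_smul, Real.norm_of_nonneg hc]]
  refine lp.norm_mono (p := 2)
    (x := (show lp (fun _ : ℤ => EuclideanSpace ℂ (Fin n)) 2 from multiplier s t n m hm γ))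
    (y := (show lp (fun _ : ℤ => EuclideanSpace ℂ (Fin n)) 2 from c • γ)) (by norm_num)
    fun k => ?_
  change ‖m k • γ.ncoeff k‖ ≤ ‖c • γ.ncoeff k‖
  rw [norm_smul, norm_smul, Real.norm_eq_abs, Real.norm_of_nonneg hc]
  exact mul_le_mul_of_nonneg_right (h k) (norm_nonneg _)

theorem norm_multiplier_apply_le (m : ℤ → ℝ) (hm : ∀ k, |m k| ≤ 1) (γ : Loop s n) :
    ‖multiplier s t n m hm γ‖ ≤ ‖γ‖ := by
  simpa using (multiplier s t n m hm).le_of_opNorm_le (norm_multiplier_le m hm zero_le_one hm) γ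

theorem norm_incl_le (h : s ≤ t) (γ : Loop t n) : ‖incl n h γ‖ ≤ ‖γ‖ :=
  norm_multiplier_apply_le _ _ γ

/-- A multiplier whose symbol tends to zero is the norm limit of its finite truncations, hence
compact. -/
theorem isCompactOperator_multiplier (m : ℤ → ℝ) (hm : ∀ k, |m k| ≤ 1)
    (h0 : Tendsto m cofinite (𝓝 0)) : IsCompactOperator (multiplier s t n m hm) := by
  classical
  have hmF : ∀ (F : Finset ℤ) k, |if k ∈ F then m k else 0| ≤ 1 := fun F k => by
    split_ifs
    · exact hm k
    · simp
  refine isCompactOperator_of_tendsto (l := atTop)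
    (F := fun F : Finset ℤ => multiplier s t n (fun k => if k ∈ F then m k else 0) (hmF F)) ?_
    (Eventually.of_forall fun F => ?_)
  · rw [Metric.tendsto_atTop]
    intro ε hε
    have hfin : {k | ¬ |m k| < ε / 2}.Finite := by
      have := (h0.abs.eventually (gt_mem_nhds (by simpa using half_pos hε : |(0 : ℝ)| < ε / 2)))
      exact this
    refine ⟨hfin.toFinset, fun F hF => ?_⟩
    have hd : ∀ k, |(if k ∈ F then m k else 0) - m k| ≤ 1 := fun k => by
      split_ifs
      · simp
      · simpa using hm k
    have he : multiplier s t n (fun k => if k ∈ F then m k else 0) (hmF F) - multiplier s t n m hm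
        = multiplier s t n (fun k => (if k ∈ F then m k else 0) - m k) hd := by
      ext1 γ
      apply ncoeff_ext
      intro k
      exact (sub_smul _ _ _).symm
    rw [dist_eq_norm, he]
    refine (norm_multiplier_le _ hd (half_pos hε).le fun k => ?_).trans_lt (half_lt_self hε)
    split_ifs with hk
    · simpa using (half_pos hε).le
    · have : ¬ ¬ |m k| < ε / 2 := fun hcon => hk (hF (hfin.mem_toFinset.2 hcon))
      simpa using (not_not.1 this).le
  · have he : multiplier s t n (fun k => if k ∈ F then m k else 0) (hmF F) =
        ∑ k ∈ F, (singleL t n k) ∘L (m k • ncoeffL s n k) := by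
      ext1 γ
      apply ncoeff_ext
      intro j
      rw [sum_apply, ncoeff_sum, ncoeff_multiplier]
      simp only [ContinuousLinearMap.comp_apply, ncoeff_singleL]
      rw [Finset.sum_ite_eq]
      split_ifs
      · rfl
      · simp
    rw [he]
    have hmem : ∑ k ∈ F, (singleL t n k) ∘L (m k • ncoeffL s n k) ∈
        compactOperator (RingHom.id ℝ) (Loop s n) (Loop t n) := by
      refine Submodule.sum_mem _ fun k _ => ?_
      have : IsCompactOperator (m k • ncoeffL s n k) :=
        isCompactOperator_of_locallyCompactSpace_dom _
      exact this.clm_comp (singleL t n k)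
    exact hmem

/-- Rellich's theorem for Sobolev spaces of loops. -/
theorem isCompactOperator_incl (h : s < t) : IsCompactOperator (incl n h.le) := by
  refine isCompactOperator_multiplier _ _ ?_
  have h1 : Tendsto (fun k : ℤ => |(k : ℝ)| ^ (-(t - s))) cofinite (𝓝 0) := by
    refine (tendsto_rpow_neg_atTop (sub_pos.2 h)).comp ?_
    have := tendsto_norm_cocompact_atTop (E := ℤ)
    rw [cocompact_eq_cofinite] at this
    exact this
  refine h1.congr' ?_
  filter_upwards [(Set.finite_singleton (0 : ℤ)).compl_mem_cofinite] with k hk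
  have hk : k ≠ 0 := hk
  have hk' : 0 < |(k : ℝ)| := by positivity
  rw [weight, weight, if_neg hk, if_neg hk, ← Real.rpow_sub hk']
  congr 1
  ring

theorem denseRange_incl (h : s ≤ t) : DenseRange (incl n h) := by
  classical
  intro γ
  have hs : HasSum (fun k => singleL s n k (γ.ncoeff k)) γ :=
    lp.hasSum_single (p := 2) (by norm_num)
      (show lp (fun _ : ℤ => EuclideanSpace ℂ (Fin n)) 2 from γ)
  refine mem_closure_of_tendsto hs (Eventually.of_forall fun F => ?_)
  refine ⟨∑ k ∈ F, singleL t n k ((weight s k / weight t k)⁻¹ • γ.ncoeff k), ?_⟩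
  rw [map_sum]
  refine Finset.sum_congr rfl fun k _ => ncoeff_ext fun j => ?_
  rw [incl, ncoeff_multiplier, ncoeff_singleL, ncoeff_singleL]
  split_ifs with hj
  · subst hj
    have h1 := weight_pos s j
    have h2 := weight_pos t j
    rw [smul_inv_smul₀ (by positivity)]
  · exact smul_zero _

theorem coeff_sub (γ δ : Loop s n) (k : ℤ) : (γ - δ).coeff k = γ.coeff k - δ.coeff k :=
  smul_sub (weight s k)⁻¹ (γ.ncoeff k) (δ.ncoeff k)

end Loop

/-- The inclusion of `L²_{1/2}` into `L²`. -/
noncomputable def inclZero (n : ℕ) : LoopHalf n →L[ℝ] Loop 0 n := Loop.incl n (by norm_num)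

theorem isCompactOperator_inclZero (n : ℕ) : IsCompactOperator (inclZero n) :=
  Loop.isCompactOperator_incl (by norm_num)

theorem isCompactOperator_inclTwo (n : ℕ) : IsCompactOperator (inclTwo n) :=
  Loop.isCompactOperator_incl (by norm_num)

/-- The operator `sign (-J ∂_θ)` on `L²_{1/2}`. -/
noncomputable def signOp (n : ℕ) : LoopHalf n →L[ℝ] LoopHalf n :=
  Loop.multiplier (1 / 2) (1 / 2) n (fun k => (SignType.sign k : ℝ)) fun k => by
    rcases lt_trichotomy k 0 with h | h | h <;> simp [h]

theorem norm_signOp_le {n : ℕ} (γ : LoopHalf n) : ‖signOp n γ‖ ≤ ‖γ‖ :=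
  Loop.norm_multiplier_apply_le _ _ γ

/-- The weights of `L²_{1/2}` turn the quadratic part of the action into a bounded form. -/
theorem tsum_mul_norm_coeff_sq {n : ℕ} (γ : LoopHalf n) :
    ∑' k : ℤ, (k : ℝ) * ‖γ.coeff k‖ ^ 2 = inner ℝ (signOp n γ) γ := by
  have h := lp.inner_eq_tsum (𝕜 := ℝ)
    (show lp (fun _ : ℤ => EuclideanSpace ℂ (Fin n)) 2 from signOp n γ)
    (show lp (fun _ : ℤ => EuclideanSpace ℂ (Fin n)) 2 from γ)
  refine Eq.trans (tsum_congr fun k => ?_) h.symm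
  change _ = inner ℝ ((SignType.sign k : ℝ) • γ.ncoeff k) (γ.ncoeff k)
  rw [real_inner_smul_left, real_inner_self_eq_norm_sq, Loop.coeff, norm_smul, mul_pow,
    ← mul_assoc]
  congr 1
  by_cases hk : k = 0
  · simp [hk]
  · have hk' : 0 < |(k : ℝ)| := by positivity
    have hw : ‖(Loop.weight (1 / 2) k)⁻¹‖ ^ 2 = |(k : ℝ)|⁻¹ := by
      rw [norm_inv, Real.norm_of_nonneg (Loop.weight_pos _ _).le, inv_pow, Loop.weight, if_neg hk,
        ← Real.rpow_natCast, ← Real.rpow_mul hk'.le]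
      norm_num
    rw [hw]
    rcases lt_or_gt_of_ne hk with h | h
    · have : (k : ℝ) < 0 := by exact_mod_cast h
      simp [h, abs_of_neg this, this.ne]
    · have : (0 : ℝ) < k := by exact_mod_cast h
      simp [h, abs_of_pos this, this.ne']

/-! ### The Hamiltonian term of the action -/

namespace LoopHalf

variable {n : ℕ}

theorem memLp_eval (γ : LoopHalf n) : MemLp γ.eval 2 := by
  refine MemLp.of_eval_piLp fun j => ?_
  exact memLp_haarAddCircle_iff.1
    (Lp.memLp ((fourierBasis (T := 2 * Real.pi)).repr.symm (γ.component j)))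

theorem component_sub (γ δ : LoopHalf n) (j : Fin n) :
    (γ - δ).component j = γ.component j - δ.component j := by
  apply lp.ext
  funext k
  change (γ - δ).coeff k j = γ.coeff k j - δ.coeff k j
  rw [Loop.coeff_sub]
  rfl

theorem eval_sub (γ δ : LoopHalf n) : ∀ᵐ θ, (γ - δ).eval θ = γ.eval θ - δ.eval θ := by
  have h : ∀ j : Fin n, ∀ᵐ θ : AddCircle (2 * Real.pi),
      (fourierBasis (T := 2 * Real.pi)).repr.symm ((γ - δ).component j) θ =
        (fourierBasis (T := 2 * Real.pi)).repr.symm (γ.component j) θ -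
        (fourierBasis (T := 2 * Real.pi)).repr.symm (δ.component j) θ := fun j => by
    rw [component_sub, map_sub, AddCircle.volume_eq_smul_haarAddCircle]
    exact Measure.ae_smul_measure (Lp.coeFn_sub _ _) _
  filter_upwards [ae_all_iff.2 h] with θ hθ
  ext j
  exact hθ j

theorem norm_inclZero_sq (γ : LoopHalf n) : ‖inclZero n γ‖ ^ 2 = ∑' k : ℤ, ‖γ.coeff k‖ ^ 2 := by
  rw [Loop.norm_sq]
  refine tsum_congr fun k => ?_
  rw [inclZero, Loop.coeff_incl]
  simp [Loop.weight]

theorem norm_component_sq (γ : LoopHalf n) (j : Fin n) :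
    HasSum (fun k : ℤ => ‖γ.coeff k j‖ ^ 2) (‖γ.component j‖ ^ 2) := by
  have := lp.hasSum_norm (p := 2) (by norm_num) (γ.component j)
  simp only [ENNReal.toReal_ofNat, Real.rpow_ofNat] at this
  exact this

/-- Parseval's identity. -/
theorem integral_norm_eval_sq (γ : LoopHalf n) :
    ∫ θ, ‖γ.eval θ‖ ^ 2 = 2 * Real.pi * ‖inclZero n γ‖ ^ 2 := by
  have h1 : ∀ j : Fin n, ∫ θ, ‖γ.eval θ j‖ ^ 2 = 2 * Real.pi * ‖γ.component j‖ ^ 2 := fun j => by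
    set f := (fourierBasis (T := 2 * Real.pi)).repr.symm (γ.component j) with hf
    have h2 : ‖f‖ ^ 2 = ∫ θ, ‖f θ‖ ^ 2 ∂AddCircle.haarAddCircle := by
      have := congrArg Complex.re (L2.inner_def (𝕜 := ℂ) f f)
      rw [inner_self_eq_norm_sq_to_K] at this
      have e : ∀ θ, inner ℂ (f θ) (f θ) = ((‖f θ‖ ^ 2 : ℝ) : ℂ) := fun θ => by
        rw [inner_self_eq_norm_sq_to_K]; norm_cast
      simp_rw [e] at this
      rw [integral_complex_ofReal] at this
      norm_cast at this
    rw [AddCircle.integral_haarAddCircle] at h2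
    rw [← (fourierBasis (T := 2 * Real.pi)).repr.symm.norm_map (γ.component j), ← hf, h2,
      smul_eq_mul, mul_inv_cancel_left₀ Real.two_pi_pos.ne']
    rfl
  have h3 : ∀ j : Fin n, Integrable fun θ => ‖γ.eval θ j‖ ^ 2 := fun j =>
    (γ.memLp_eval.eval_piLp j).integrable_norm_pow (by norm_num)
  simp_rw [EuclideanSpace.norm_sq_eq]
  rw [integral_finsetSum _ fun j _ => h3 j, Finset.sum_congr rfl fun j _ => h1 j,
    ← Finset.mul_sum, norm_inclZero_sq]
  congr 1
  simp_rw [EuclideanSpace.norm_sq_eq]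
  rw [Summable.tsum_finsetSum fun j _ => (norm_component_sq γ j).summable]
  exact Finset.sum_congr rfl fun j _ => (norm_component_sq γ j).tsum_eq.symm

theorem memLp_one_add_norm (a b : LoopHalf n) :
    MemLp (fun θ => 1 + ‖a.eval θ‖ + ‖b.eval θ‖) 2 := by
  have h1 : MemLp (fun _ : AddCircle (2 * Real.pi) => (1 : ℝ)) 2 := memLp_const 1
  exact (h1.add a.memLp_eval.norm).add b.memLp_eval.norm

theorem integrable_mul_norm_eval (c : LoopHalf n)
    {f : AddCircle (2 * Real.pi) → ℝ} (hf : MemLp f 2) :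
    Integrable fun θ => f θ * ‖c.eval θ‖ := by
  have h := c.memLp_eval.norm
  exact hf.integrable_mul h

/-- Cauchy–Schwarz, with Parseval's identity for the right-hand factor. -/
theorem integral_mul_norm_eval_le (c : LoopHalf n)
    {f : AddCircle (2 * Real.pi) → ℝ} (hf : MemLp f 2) (hf0 : ∀ θ, 0 ≤ f θ) :
    ∫ θ, f θ * ‖c.eval θ‖ ≤ √(∫ θ, f θ ^ 2) * (√(2 * Real.pi) * ‖inclZero n c‖) := by
  have hP := Real.pi_pos
  have h2 := integral_mul_le_Lp_mul_Lq_of_nonneg (μ := volume) Real.HolderConjugate.two_two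
    (f := f) (g := fun θ => ‖c.eval θ‖) (Eventually.of_forall hf0)
    (Eventually.of_forall fun θ => norm_nonneg _) (by simpa using hf)
    (by simpa using c.memLp_eval.norm)
  have h3 : √(∫ θ, ‖c.eval θ‖ ^ 2) = √(2 * Real.pi) * ‖inclZero n c‖ := by
    rw [LoopHalf.integral_norm_eval_sq, Real.sqrt_mul (by positivity),
      Real.sqrt_sq (norm_nonneg _)]
  rw [← h3]
  simpa only [Real.sqrt_eq_rpow, Real.rpow_ofNat] using h2

theorem sqrt_integral_sq_le (a b : LoopHalf n) :
    √(∫ θ, (1 + ‖a.eval θ‖ + ‖b.eval θ‖) ^ 2) ≤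
      √(2 * Real.pi) * (2 * (1 + ‖inclZero n a‖ + ‖inclZero n b‖)) := by
  have hP := Real.pi_pos
  have ia := a.memLp_eval.integrable_norm_pow (p := 2) (by norm_num)
  have ib := b.memLp_eval.integrable_norm_pow (p := 2) (by norm_num)
  have i1 : Integrable (fun _ : AddCircle (2 * Real.pi) => (1 : ℝ)) := integrable_const 1
  have h5 : ∫ θ, (1 + ‖a.eval θ‖ + ‖b.eval θ‖) ^ 2 ≤
      ∫ θ, 3 * (1 + ‖a.eval θ‖ ^ 2 + ‖b.eval θ‖ ^ 2) := by
    refine integral_mono_of_nonneg (Eventually.of_forall fun θ => sq_nonneg _)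
      (((i1.add ia).add ib).const_mul 3) (Eventually.of_forall fun θ => ?_)
    change (1 + ‖a.eval θ‖ + ‖b.eval θ‖) ^ 2 ≤ 3 * (1 + ‖a.eval θ‖ ^ 2 + ‖b.eval θ‖ ^ 2)
    nlinarith [sq_nonneg (1 - ‖a.eval θ‖), sq_nonneg (1 - ‖b.eval θ‖),
      sq_nonneg (‖a.eval θ‖ - ‖b.eval θ‖)]
  have h6 : ∫ θ, 3 * (1 + ‖a.eval θ‖ ^ 2 + ‖b.eval θ‖ ^ 2) =
      3 * (2 * Real.pi * (1 + ‖inclZero n a‖ ^ 2 + ‖inclZero n b‖ ^ 2)) := by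
    have iab : Integrable (fun θ => 1 + ‖a.eval θ‖ ^ 2) := i1.add ia
    rw [integral_const_mul, integral_add iab ib, integral_add i1 ia,
      LoopHalf.integral_norm_eval_sq, LoopHalf.integral_norm_eval_sq, integral_const,
      Measure.real, AddCircle.measure_univ, ENNReal.toReal_ofReal Real.two_pi_pos.le, smul_eq_mul]
    ring
  rw [Real.sqrt_le_left (by positivity), mul_pow, Real.sq_sqrt (by positivity)]
  refine (h5.trans_eq h6).trans ?_
  have hA := norm_nonneg (inclZero n a)
  have hB := norm_nonneg (inclZero n b)
  have : 3 * (1 + ‖inclZero n a‖ ^ 2 + ‖inclZero n b‖ ^ 2) ≤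
      (2 * (1 + ‖inclZero n a‖ + ‖inclZero n b‖)) ^ 2 := by
    nlinarith [mul_nonneg hA hB]
  nlinarith

end LoopHalf

namespace IsAdmissibleHamiltonian

variable {n : ℕ} {H : EuclideanSpace ℂ (Fin n) → ℝ}

/-- `H` differs from `(1 + ε)|x|²` by a compactly supported, hence Lipschitz, function. -/
theorem exists_abs_sub_le (hH : IsAdmissibleHamiltonian H) :
    ∃ C, 0 ≤ C ∧ ∀ x y, |H x - H y| ≤ C * (1 + ‖x‖ + ‖y‖) * ‖x - y‖ := by
  obtain ⟨ε, R, hR⟩ := hH.quadratic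
  let g : EuclideanSpace ℂ (Fin n) → ℝ := fun x => H x - (1 + ε) * ‖x‖ ^ 2
  have hg : ContDiff ℝ ∞ g := hH.smooth.sub (contDiff_const.mul (contDiff_norm_sq ℝ))
  have hgc : HasCompactSupport g := by
    refine HasCompactSupport.intro (isCompact_closedBall 0 R) fun x hx => ?_
    have : R ≤ ‖x‖ := by
      rw [mem_closedBall_zero_iff, not_le] at hx
      exact hx.le
    simp [g, hR x this]
  obtain ⟨L, hL⟩ := hg.lipschitzWith_of_hasCompactSupport hgc (by simp)
  refine ⟨L + |1 + ε|, by positivity, fun x y => ?_⟩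
  have h1 : |g x - g y| ≤ L * ‖x - y‖ := by
    simpa [Real.dist_eq, dist_eq_norm] using hL.dist_le_mul x y
  have h2 : |‖x‖ ^ 2 - ‖y‖ ^ 2| ≤ (‖x‖ + ‖y‖) * ‖x - y‖ := by
    rw [sq_sub_sq, abs_mul, abs_of_nonneg (by positivity)]
    exact mul_le_mul_of_nonneg_left (abs_norm_sub_norm_le x y) (by positivity)
  have h3 : H x - H y = (g x - g y) + (1 + ε) * (‖x‖ ^ 2 - ‖y‖ ^ 2) := by simp only [g]; ring
  rw [h3]
  refine (abs_add_le _ _).trans ?_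
  rw [abs_mul]
  have h4 := mul_le_mul_of_nonneg_left h2 (abs_nonneg (1 + ε))
  have h5 : 0 ≤ (L : ℝ) * ((‖x‖ + ‖y‖) * ‖x - y‖) := by positivity
  have h6 : 0 ≤ |1 + ε| * ‖x - y‖ := by positivity
  nlinarith

theorem integrable_comp_eval (hH : IsAdmissibleHamiltonian H) (γ : LoopHalf n) :
    Integrable fun θ => H (γ.eval θ) := by
  obtain ⟨C, hC, h⟩ := hH.exists_abs_sub_le
  have h1 := γ.memLp_eval.integrable_norm_pow (p := 2) (by norm_num)
  have h2 := γ.memLp_eval.integrable (by norm_num)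
  refine Integrable.mono' (((integrable_const |H 0|).add (h2.norm.const_mul C)).add
    (h1.const_mul C)) (hH.smooth.continuous.comp_aestronglyMeasurable
      γ.memLp_eval.aestronglyMeasurable) (Eventually.of_forall fun θ => ?_)
  have h3 := h (γ.eval θ) 0
  have h4 := abs_add_le (H (γ.eval θ) - H 0) (H 0)
  simp only [norm_zero, sub_zero, add_zero] at h3
  rw [sub_add_cancel] at h4
  change |H (γ.eval θ)| ≤ |H 0| + C * ‖γ.eval θ‖ + C * ‖γ.eval θ‖ ^ 2
  nlinarith

/-- The Hamiltonian term of the action is locally Lipschitz for the `L²`-norm. -/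
theorem exists_abs_integral_sub_le (hH : IsAdmissibleHamiltonian H) :
    ∃ C, 0 ≤ C ∧ ∀ a b : LoopHalf n, |(∫ θ, H (a.eval θ)) - ∫ θ, H (b.eval θ)| ≤
      C * (1 + ‖inclZero n a‖ + ‖inclZero n b‖) * ‖inclZero n (a - b)‖ := by
  obtain ⟨C, hC, h⟩ := hH.exists_abs_sub_le
  refine ⟨C * (2 * (2 * Real.pi)), by positivity, fun a b => ?_⟩
  rw [← integral_sub (hH.integrable_comp_eval a) (hH.integrable_comp_eval b)]
  have hf := a.memLp_one_add_norm b
  have hfg := (a - b).integrable_mul_norm_eval hf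
  have h1 : |∫ θ, H (a.eval θ) - H (b.eval θ)| ≤
      C * ∫ θ, (1 + ‖a.eval θ‖ + ‖b.eval θ‖) * ‖(a - b).eval θ‖ := by
    rw [← integral_const_mul, ← Real.norm_eq_abs]
    refine norm_integral_le_of_norm_le (hfg.const_mul C) ?_
    filter_upwards [LoopHalf.eval_sub a b] with θ hθ
    have := h (a.eval θ) (b.eval θ)
    rw [← hθ] at this
    rw [Real.norm_eq_abs, ← mul_assoc]
    exact this
  have h2 := (a - b).integral_mul_norm_eval_le hf fun θ => by positivity
  have h4 := LoopHalf.sqrt_integral_sq_le a b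
  have h7 : √(2 * Real.pi) * √(2 * Real.pi) = 2 * Real.pi :=
    Real.mul_self_sqrt Real.two_pi_pos.le
  refine (h1.trans (mul_le_mul_of_nonneg_left (h2.trans
    (mul_le_mul_of_nonneg_right h4 (by positivity))) hC)).trans_eq ?_
  linear_combination C * 2 * (1 + ‖inclZero n a‖ + ‖inclZero n b‖) * ‖inclZero n (a - b)‖ * h7

end IsAdmissibleHamiltonian

/-! ### Variation of the action -/

section Action

variable {n : ℕ} {H : EuclideanSpace ℂ (Fin n) → ℝ}

theorem actionFunctional_add_sub (γ u : LoopHalf n) :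
    actionFunctional H (γ + u) - actionFunctional H γ =
      Real.pi * (inner ℝ (signOp n γ) u + inner ℝ (signOp n u) γ + inner ℝ (signOp n u) u) -
        ((∫ θ, H ((γ + u).eval θ)) - ∫ θ, H (γ.eval θ)) := by
  rw [actionFunctional, actionFunctional, tsum_mul_norm_coeff_sq, tsum_mul_norm_coeff_sq, map_add,
    inner_add_left, inner_add_right, inner_add_right]
  ring

namespace IsAdmissibleHamiltonian

theorem exists_abs_actionFunctional_add_sub_le (hH : IsAdmissibleHamiltonian H) :
    ∃ C, 0 ≤ C ∧ ∀ γ u : LoopHalf n,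
      |actionFunctional H (γ + u) - actionFunctional H γ| ≤ C * (1 + ‖γ‖ + ‖u‖) * ‖u‖ := by
  obtain ⟨C, hC, h⟩ := hH.exists_abs_integral_sub_le
  have hpi := Real.pi_pos
  refine ⟨Real.pi * 2 + C * 2, by positivity, fun γ u => ?_⟩
  rw [actionFunctional_add_sub]
  have hγ := norm_nonneg γ
  have hu := norm_nonneg u
  have h1 : |inner ℝ (signOp n γ) u| ≤ ‖γ‖ * ‖u‖ := (abs_real_inner_le_norm _ _).trans
    (mul_le_mul_of_nonneg_right (norm_signOp_le γ) hu)
  have h2 : |inner ℝ (signOp n u) γ| ≤ ‖u‖ * ‖γ‖ := (abs_real_inner_le_norm _ _).trans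
    (mul_le_mul_of_nonneg_right (norm_signOp_le u) hγ)
  have h3 : |inner ℝ (signOp n u) u| ≤ ‖u‖ * ‖u‖ := (abs_real_inner_le_norm _ _).trans
    (mul_le_mul_of_nonneg_right (norm_signOp_le u) hu)
  have h4 := h (γ + u) γ
  rw [add_sub_cancel_left] at h4
  have h5 : ∀ δ : LoopHalf n, ‖inclZero n δ‖ ≤ ‖δ‖ := Loop.norm_incl_le _
  have h6 : C * (1 + ‖inclZero n (γ + u)‖ + ‖inclZero n γ‖) * ‖inclZero n u‖ ≤
      C * (1 + (‖γ‖ + ‖u‖) + ‖γ‖) * ‖u‖ := by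
    gcongr
    · exact (h5 _).trans (norm_add_le _ _)
    · exact h5 _
    · exact h5 _
  refine (abs_sub _ _).trans ?_
  rw [abs_mul, abs_of_pos hpi]
  have h7 : |inner ℝ (signOp n γ) u + inner ℝ (signOp n u) γ + inner ℝ (signOp n u) u| ≤
      2 * (‖γ‖ + ‖u‖) * ‖u‖ := by
    refine (abs_add_three _ _ _).trans ?_
    nlinarith
  have h8 := mul_le_mul_of_nonneg_left h7 hpi.le
  have h9 : 0 ≤ Real.pi * ‖u‖ := by positivity
  have h10 : 0 ≤ C * ‖u‖ := by positivity
  nlinarith [mul_nonneg h10 hu, mul_nonneg h10 hγ]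

/-- The Hamiltonian term is continuous for `L²`-convergence. -/
theorem tendsto_integral (hH : IsAdmissibleHamiltonian H) {α : Type*} {l : Filter α}
    {z : α → LoopHalf n} {w : LoopHalf n}
    (h : Tendsto (fun a => inclZero n (z a)) l (𝓝 (inclZero n w))) :
    Tendsto (fun a => ∫ θ, H ((z a).eval θ)) l (𝓝 (∫ θ, H (w.eval θ))) := by
  obtain ⟨C, -, hC⟩ := hH.exists_abs_integral_sub_le
  rw [tendsto_iff_norm_sub_tendsto_zero]
  refine squeeze_zero (fun _ => norm_nonneg _) (fun a => hC (z a) w) ?_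
  have h1 : Tendsto (fun a => ‖inclZero n (z a - w)‖) l (𝓝 0) := by
    simp_rw [map_sub]
    exact tendsto_iff_norm_sub_tendsto_zero.1 h
  have h2 := (((tendsto_const_nhds (x := (1 : ℝ))).add h.norm).add
    (tendsto_const_nhds (x := ‖inclZero n w‖))).const_mul C
  simpa using h2.mul h1

/-- The variation of the action under a norm convergent perturbation is continuous along bounded
weakly convergent families: the mixed quadratic terms pair a weakly with a norm convergent family,
and by Rellich's theorem the Hamiltonian terms converge. -/
theorem tendsto_actionFunctional_add_sub (hH : IsAdmissibleHamiltonian H) {α : Type*}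
    {l : Filter α} {x u : α → LoopHalf n} {y v : LoopHalf n} {M : ℝ}
    (hM : ∀ᶠ a in l, ‖x a‖ ≤ M)
    (hx : Tendsto (fun a => toWeakSpace ℝ (LoopHalf n) (x a)) l
      (𝓝 (toWeakSpace ℝ (LoopHalf n) y)))
    (hu : Tendsto u l (𝓝 v)) :
    Tendsto (fun a => actionFunctional H (x a + u a) - actionFunctional H (x a)) l
      (𝓝 (actionFunctional H (y + v) - actionFunctional H y)) := by
  simp_rw [actionFunctional_add_sub]
  have hx' := tendsto_toWeakSpace_iff.1 hx
  have hS : Tendsto (fun a => signOp n (u a)) l (𝓝 (signOp n v)) :=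
    ((signOp n).continuous.tendsto v).comp hu
  -- replace the norm convergent factor of each mixed term by its limit
  have hsmall : ∀ (T : LoopHalf n →L[ℝ] LoopHalf n), (∀ γ, ‖T γ‖ ≤ ‖γ‖) →
      ∀ (p : α → LoopHalf n) (q : LoopHalf n), Tendsto p l (𝓝 q) →
      Tendsto (fun a => inner ℝ (T (x a)) (p a)) l (𝓝 (inner ℝ (T y) q)) := by
    intro T hT p q hp
    have h1 : Tendsto (fun a => inner ℝ (T (x a)) q) l (𝓝 (inner ℝ (T y) q)) := by
      have := hx' ((innerSL ℝ q) ∘L T)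
      simpa [real_inner_comm] using this
    have h2 : Tendsto (fun a => inner ℝ (T (x a)) (p a - q)) l (𝓝 0) := by
      have h3 : Tendsto (fun a => M * ‖p a - q‖) l (𝓝 0) := by
        simpa using (tendsto_iff_norm_sub_tendsto_zero.1 hp).const_mul M
      refine squeeze_zero_norm' ?_ h3
      filter_upwards [hM] with a ha
      exact (norm_inner_le_norm _ _).trans
        (mul_le_mul_of_nonneg_right ((hT _).trans ha) (norm_nonneg _))
    have h4 := h1.add h2
    rw [add_zero] at h4
    refine h4.congr fun a => ?_
    rw [← inner_add_right, add_sub_cancel]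
  have h1 := hsmall (signOp n) norm_signOp_le u v hu
  have h2 := hsmall (ContinuousLinearMap.id ℝ _) (fun _ => le_rfl) _ _ hS
  simp only [ContinuousLinearMap.id_apply, real_inner_comm (signOp n _) _] at h2
  have h3 : Tendsto (fun a => inner ℝ (signOp n (u a)) (u a)) l (𝓝 (inner ℝ (signOp n v) v)) :=
    hS.inner hu
  have h0 := (isCompactOperator_inclZero n).tendsto_of_tendsto_toWeakSpace hM hx
  have h4 := hH.tendsto_integral h0
  have h5 : Tendsto (fun a => inclZero n (x a + u a)) l (𝓝 (inclZero n (y + v))) := by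
    simp_rw [map_add]
    exact h0.add (((inclZero n).continuous.tendsto v).comp hu)
  exact (((h1.add h2).add h3).const_mul Real.pi).sub ((hH.tendsto_integral h5).sub h4)

end IsAdmissibleHamiltonian

end Action

/-! ### Size of the perturbation -/

namespace IsCutoff

variable {ρ : ℝ → ℝ}

theorem exists_le (hρ : IsCutoff ρ) : ∃ B, 0 ≤ B ∧ ∀ x, ρ x ≤ B := by
  obtain ⟨B, hB⟩ := (isCompact_Icc (a := (-2 : ℝ)) (b := 2)).bddAbove_image
    hρ.smooth.continuous.continuousOn
  refine ⟨max B 1, by positivity, fun x => ?_⟩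
  by_cases hx : x ∈ Icc (-2 : ℝ) 2
  · exact (hB ⟨x, hx, rfl⟩).trans (le_max_left _ _)
  · refine le_trans ?_ (le_max_right _ _)
    rw [hρ.eq_inv_sq x hx, div_le_one_iff]
    have : 1 ≤ x ^ 2 := by
      by_contra hcon
      exact hx ⟨by nlinarith, by nlinarith⟩
    exact Or.inl ⟨by positivity, this⟩

/-- The decay of the cutoff beats the linear growth of the variation of the action. -/
theorem sq_mul_le (hρ : IsCutoff ρ) {t : ℝ} (ht : 2 ≤ t) : ρ (t ^ 2) * (1 + t) ≤ 2 / t := by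
  rw [hρ.eq_inv_sq]
  · rw [div_mul_eq_mul_div, div_le_div_iff₀ (by positivity) (by positivity)]
    have h1 : 1 ≤ t ^ 2 := by nlinarith
    nlinarith [mul_le_mul h1 h1 zero_le_one (by positivity)]
  · rintro ⟨-, h⟩
    nlinarith

theorem tendsto_sq_mul (hρ : IsCutoff ρ) :
    Tendsto (fun t : ℝ => ρ (t ^ 2) * (1 + t)) atTop (𝓝 0) := by
  refine squeeze_zero' ?_ ?_ (tendsto_const_nhds.div_atTop tendsto_id : Tendsto
    (fun t : ℝ => 2 / t) atTop (𝓝 0))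
  · filter_upwards [eventually_ge_atTop 0] with t ht
    exact mul_nonneg (hρ.pos _).le (by positivity)
  · filter_upwards [eventually_ge_atTop 2] with t ht using hρ.sq_mul_le ht

theorem exists_sq_mul_le (hρ : IsCutoff ρ) : ∃ B, ∀ t, 0 ≤ t → ρ (t ^ 2) * (1 + t) ≤ B := by
  obtain ⟨B, hB0, hB⟩ := hρ.exists_le
  refine ⟨max (B * 3) 1, fun t ht => ?_⟩
  rcases le_total t 2 with h | h
  · refine le_trans ?_ (le_max_left _ _)
    exact mul_le_mul (hB _) (by linarith) (by linarith) hB0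
  · refine (hρ.sq_mul_le h).trans (le_trans ?_ (le_max_right _ _))
    rw [div_le_one (by linarith)]
    exact h

end IsCutoff

theorem norm_le_one_of_mem_pertBall {n : ℕ} {v : LoopHalf n} (hv : v ∈ pertBall n) : ‖v‖ ≤ 1 := by
  obtain ⟨w, hw, rfl⟩ := hv
  exact (Loop.norm_incl_le _ w).trans (by simpa using hw)

/-- The variation of the action under the perturbation is controlled by `ρ(‖γ‖²)(1 + ‖γ‖)`. -/
theorem IsAdmissibleHamiltonian.exists_abs_perturb_sub_le {n : ℕ}
    {H : EuclideanSpace ℂ (Fin n) → ℝ} (hH : IsAdmissibleHamiltonian H)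
    {ρ : ℝ → ℝ} (hρ : IsCutoff ρ) :
    ∃ C, 0 ≤ C ∧ ∀ γ v : LoopHalf n, ‖v‖ ≤ 1 →
      |actionFunctional H (γ + ρ (‖γ‖ ^ 2) • v) - actionFunctional H γ| ≤
        C * (ρ (‖γ‖ ^ 2) * (1 + ‖γ‖)) := by
  obtain ⟨C, hC0, hC⟩ := hH.exists_abs_actionFunctional_add_sub_le
  obtain ⟨B, hB0, hB⟩ := hρ.exists_le
  refine ⟨C * (1 + B), by positivity, fun γ v hv => (hC γ _).trans ?_⟩
  have hr := hρ.pos (‖γ‖ ^ 2)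
  have h1 : ‖ρ (‖γ‖ ^ 2) • v‖ ≤ ρ (‖γ‖ ^ 2) := by
    rw [norm_smul, Real.norm_of_nonneg hr.le]
    exact mul_le_of_le_one_right hr.le hv
  have h2 := hB (‖γ‖ ^ 2)
  have hγ := norm_nonneg γ
  calc C * (1 + ‖γ‖ + ‖ρ (‖γ‖ ^ 2) • v‖) * ‖ρ (‖γ‖ ^ 2) • v‖
      ≤ C * ((1 + B) * (1 + ‖γ‖)) * ρ (‖γ‖ ^ 2) := by
        gcongr
        nlinarith
    _ = _ := by ring

/-! ### The functional-analytic chain axioms for the perturbed family -/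

section PerturbedAxioms

variable {n : ℕ} {H : EuclideanSpace ℂ (Fin n) → ℝ} {ρ : ℝ → ℝ} {P K : Type*} {σ : P → LoopHalf n}
  {ι : K → LoopHalf n}

theorem bddBelow_perturb (hH : IsAdmissibleHamiltonian H) (hρ : IsCutoff ρ)
    (hι : ∀ k, ‖ι k‖ ≤ 1) (hσ : BddBelow (actionFunctional H '' range σ)) :
    BddBelow (actionFunctional H '' range fun q : P × K => perturb ρ σ q.1 (ι q.2)) := by
  obtain ⟨C, hC0, hC⟩ := hH.exists_abs_perturb_sub_le hρ
  obtain ⟨B, hB⟩ := hρ.exists_sq_mul_le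
  obtain ⟨m, hm⟩ := hσ
  refine ⟨m - C * B, ?_⟩
  rintro _ ⟨_, ⟨⟨x, k⟩, rfl⟩, rfl⟩
  have h1 := hm ⟨_, ⟨x, rfl⟩, rfl⟩
  have h2 := (abs_le.1 (hC (σ x) (ι k) (hι k))).1
  have h3 := mul_le_mul_of_nonneg_left (hB ‖σ x‖ (norm_nonneg _)) hC0
  change m - C * B ≤ actionFunctional H (σ x + ρ (‖σ x‖ ^ 2) • ι k)
  linarith

variable [TopologicalSpace K]

/-- On the region where `σ` is bounded, weak convergence of the perturbed family, together with
convergence of the parameters, gives weak convergence of `σ`, and the variation of the action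
converges. -/
theorem tendsto_of_tendsto_perturb (hH : IsAdmissibleHamiltonian H) (hι : Continuous ι)
    {α : Type*} {l : Filter α} {q : α → P × K} {w : LoopHalf n} {k : K} {r M : ℝ}
    (hw : Tendsto (fun a => toWeakSpace ℝ (LoopHalf n) (perturb ρ σ (q a).1 (ι (q a).2))) l
      (𝓝 (toWeakSpace ℝ (LoopHalf n) w)))
    (hk : Tendsto (fun a => (q a).2) l (𝓝 k))
    (hr : Tendsto (fun a => ρ (‖σ (q a).1‖ ^ 2)) l (𝓝 r))
    (hM : ∀ᶠ a in l, ‖σ (q a).1‖ ≤ M) :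
    Tendsto (fun a => toWeakSpace ℝ (LoopHalf n) (σ (q a).1)) l
      (𝓝 (toWeakSpace ℝ (LoopHalf n) (w - r • ι k))) ∧
    Tendsto (fun a => actionFunctional H (perturb ρ σ (q a).1 (ι (q a).2)) -
      actionFunctional H (σ (q a).1)) l
      (𝓝 (actionFunctional H w - actionFunctional H (w - r • ι k))) := by
  have hu : Tendsto (fun a => ρ (‖σ (q a).1‖ ^ 2) • ι (q a).2) l (𝓝 (r • ι k)) :=
    hr.smul ((hι.tendsto k).comp hk)
  have hσ : Tendsto (fun a => toWeakSpace ℝ (LoopHalf n) (σ (q a).1)) l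
      (𝓝 (toWeakSpace ℝ (LoopHalf n) (w - r • ι k))) := by
    rw [tendsto_toWeakSpace_iff] at hw ⊢
    intro f
    have h1 := (hw f).sub ((f.continuous.tendsto _).comp hu)
    rw [← map_sub] at h1
    refine h1.congr fun a => ?_
    simp [perturb]
  refine ⟨hσ, ?_⟩
  have := hH.tendsto_actionFunctional_add_sub hM hσ hu
  rwa [sub_add_cancel] at this

/-- Along an ultrafilter on the parameter space for which the perturbed family converges weakly
to `w`, the family `σ` converges weakly to some `y`, and the variation of the action converges to
its value at the limits.  Either `σ` stays bounded, or its norm tends to infinity, in which case the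
perturbation disappears in the limit. -/
theorem exists_tendsto_of_ultrafilter (hH : IsAdmissibleHamiltonian H) (hρ : IsCutoff ρ)
    [CompactSpace K] (hι : Continuous ι) (hι1 : ∀ k, ‖ι k‖ ≤ 1) (g : Ultrafilter (P × K))
    {w : LoopHalf n}
    (hw : Tendsto (fun q : P × K => toWeakSpace ℝ (LoopHalf n) (perturb ρ σ q.1 (ι q.2))) g
      (𝓝 (toWeakSpace ℝ (LoopHalf n) w))) :
    ∃ y, Tendsto (fun q : P × K => toWeakSpace ℝ (LoopHalf n) (σ q.1)) g
        (𝓝 (toWeakSpace ℝ (LoopHalf n) y)) ∧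
      Tendsto (fun q : P × K => actionFunctional H (perturb ρ σ q.1 (ι q.2)) -
        actionFunctional H (σ q.1)) g (𝓝 (actionFunctional H w - actionFunctional H y)) := by
  by_cases hM : ∃ M, ∀ᶠ q in (g : Filter (P × K)), ‖σ q.1‖ ≤ M
  · obtain ⟨M, hM⟩ := hM
    obtain ⟨B, -, hB⟩ := hρ.exists_le
    obtain ⟨k, -, hk⟩ := isCompact_univ.ultrafilter_le_nhds (g.map Prod.snd) (by simp)
    have hmem : ∀ᶠ q in (g : Filter (P × K)), ρ (‖σ q.1‖ ^ 2) ∈ Icc 0 B :=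
      Eventually.of_forall fun q => ⟨(hρ.pos _).le, hB _⟩
    obtain ⟨r, -, hr⟩ := (isCompact_Icc (a := (0 : ℝ)) (b := B)).ultrafilter_le_nhds
      (g.map fun q => ρ (‖σ q.1‖ ^ 2)) (by
        rw [Ultrafilter.coe_map, le_principal_iff, mem_map]
        exact hmem)
    have hk' : Tendsto (fun q : P × K => q.2) g (𝓝 k) := hk
    have hr' : Tendsto (fun q : P × K => ρ (‖σ q.1‖ ^ 2)) g (𝓝 r) := hr
    exact ⟨w - r • ι k, tendsto_of_tendsto_perturb (q := fun q => q) hH hι hw hk' hr' hM⟩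
  · push Not at hM
    have hinf : Tendsto (fun q : P × K => ‖σ q.1‖) g atTop := by
      exact tendsto_atTop.2 fun M => (hM M).mono fun q hq => hq.le
    have hsq := hρ.tendsto_sq_mul.comp hinf
    obtain ⟨C, hC0, hC⟩ := hH.exists_abs_perturb_sub_le hρ
    refine ⟨w, ?_, ?_⟩
    · have hu : Tendsto (fun q : P × K => ρ (‖σ q.1‖ ^ 2) • ι q.2) g (𝓝 0) := by
        refine squeeze_zero_norm (fun q => ?_) hsq
        have hr := (hρ.pos (‖σ q.1‖ ^ 2)).le
        rw [norm_smul, Real.norm_of_nonneg hr]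
        exact mul_le_mul_of_nonneg_left
          ((hι1 _).trans (le_add_of_nonneg_right (norm_nonneg _))) hr
      rw [tendsto_toWeakSpace_iff] at hw ⊢
      intro f
      have h1 := (hw f).sub ((f.continuous.tendsto _).comp hu)
      rw [map_zero, sub_zero] at h1
      refine h1.congr fun q => ?_
      simp [perturb]
    · rw [sub_self]
      have h2 := hsq.const_mul C
      rw [mul_zero] at h2
      exact squeeze_zero_norm (fun q => hC (σ q.1) (ι q.2) (hι1 _)) h2

theorem weak_lsc_perturb (hH : IsAdmissibleHamiltonian H) (hρ : IsCutoff ρ)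
    [CompactSpace K] (hι : Continuous ι) (hι1 : ∀ k, ‖ι k‖ ≤ 1)
    (hσ : ∀ w : WeakSpace ℝ (LoopHalf n), LowerSemicontinuousWithinAt
      (fun z => actionFunctional H ((toWeakSpace ℝ (LoopHalf n)).symm z))
      (toWeakSpace ℝ (LoopHalf n) '' range σ) w)
    (w : WeakSpace ℝ (LoopHalf n)) :
    LowerSemicontinuousWithinAt
      (fun z => actionFunctional H ((toWeakSpace ℝ (LoopHalf n)).symm z))
      (toWeakSpace ℝ (LoopHalf n) '' range fun q : P × K => perturb ρ σ q.1 (ι q.2)) w := by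
  intro c hc
  by_contra hcon
  let Φ : P × K → WeakSpace ℝ (LoopHalf n) :=
    fun q => toWeakSpace ℝ (LoopHalf n) (perturb ρ σ q.1 (ι q.2))
  have hfreq : ∃ᶠ q in comap Φ (𝓝 w), actionFunctional H (perturb ρ σ q.1 (ι q.2)) ≤ c := by
    intro h
    refine hcon ?_
    rw [← range_comp, nhdsWithin, ← map_comap, eventually_map]
    exact h.mono fun q hq => not_le.1 hq
  have hne : (comap Φ (𝓝 w) ⊓
      𝓟 {q | actionFunctional H (perturb ρ σ q.1 (ι q.2)) ≤ c}).NeBot :=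
    frequently_mem_iff_neBot.1 hfreq
  obtain ⟨g, hg⟩ := Ultrafilter.exists_le (comap Φ (𝓝 w) ⊓
    𝓟 {q | actionFunctional H (perturb ρ σ q.1 (ι q.2)) ≤ c})
  have hw : Tendsto Φ g (𝓝 w) := tendsto_comap.mono_left (hg.trans inf_le_left)
  have hle : ∀ᶠ q in (g : Filter (P × K)), actionFunctional H (perturb ρ σ q.1 (ι q.2)) ≤ c :=
    le_principal_iff.1 (hg.trans inf_le_right)
  obtain ⟨w', rfl⟩ := (toWeakSpace ℝ (LoopHalf n)).surjective w
  change c < actionFunctional H w' at hc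
  obtain ⟨y, hy, hd⟩ := exists_tendsto_of_ultrafilter hH hρ hι hι1 g hw
  -- split the gap `CSD w' - c` evenly between the two limits
  have hδ : 0 < (actionFunctional H w' - c) / 2 := by linarith
  have h1 : ∀ᶠ q in (g : Filter (P × K)),
      actionFunctional H y - (actionFunctional H w' - c) / 2 < actionFunctional H (σ q.1) := by
    have hy' : Tendsto (fun q : P × K => toWeakSpace ℝ (LoopHalf n) (σ q.1)) g
        (𝓝[toWeakSpace ℝ (LoopHalf n) '' range σ] (toWeakSpace ℝ (LoopHalf n) y)) :=
      tendsto_nhdsWithin_iff.2 ⟨hy, Eventually.of_forall fun q => ⟨_, ⟨q.1, rfl⟩, rfl⟩⟩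
    have := hσ (toWeakSpace ℝ (LoopHalf n) y)
      (actionFunctional H y - (actionFunctional H w' - c) / 2)
      (sub_lt_self _ hδ)
    simpa using hy'.eventually this
  have h2 := hd.eventually (lt_mem_nhds (sub_lt_self
    (actionFunctional H w' - actionFunctional H y) hδ))
  obtain ⟨q, hq1, hq2, hq3⟩ := (h1.and (h2.and hle)).exists
  linarith

theorem strong_convergence_perturb [TopologicalSpace P] (hH : IsAdmissibleHamiltonian H)
    (hρ : IsCutoff ρ) [CompactSpace K] [FirstCountableTopology K] (hι : Continuous ι)
    (hι1 : ∀ k, ‖ι k‖ ≤ 1)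
    (hσ : ∀ (x : ℕ → P) (y : LoopHalf n),
      Tendsto (fun i => toWeakSpace ℝ (LoopHalf n) (σ (x i))) atTop
        (𝓝 (toWeakSpace ℝ (LoopHalf n) y)) →
      Tendsto (fun i => actionFunctional H (σ (x i))) atTop (𝓝 (actionFunctional H y)) →
      ∃ (p : P) (k : ℕ → ℕ), StrictMono k ∧ Tendsto (fun i => x (k i)) atTop (𝓝 p))
    (q : ℕ → P × K) (w : LoopHalf n)
    (hw : Tendsto (fun i => toWeakSpace ℝ (LoopHalf n) (perturb ρ σ (q i).1 (ι (q i).2))) atTop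
      (𝓝 (toWeakSpace ℝ (LoopHalf n) w)))
    (hc : Tendsto (fun i => actionFunctional H (perturb ρ σ (q i).1 (ι (q i).2))) atTop
      (𝓝 (actionFunctional H w))) :
    ∃ (p : P × K) (k : ℕ → ℕ), StrictMono k ∧ Tendsto (fun i => q (k i)) atTop (𝓝 p) := by
  obtain ⟨B, hB0, hB⟩ := hρ.exists_le
  obtain ⟨M, hM⟩ := exists_norm_le_of_tendsto_toWeakSpace hw
  have hbd : ∀ i, ‖σ (q i).1‖ ≤ M + B := fun i => by
    have h1 : σ (q i).1 = perturb ρ σ (q i).1 (ι (q i).2) - ρ (‖σ (q i).1‖ ^ 2) • ι (q i).2 := by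
      simp [perturb]
    have hr := (hρ.pos (‖σ (q i).1‖ ^ 2)).le
    have h2 : ‖ρ (‖σ (q i).1‖ ^ 2) • ι (q i).2‖ ≤ B := by
      rw [norm_smul, Real.norm_of_nonneg hr]
      exact (mul_le_of_le_one_right hr (hι1 _)).trans (hB _)
    rw [h1]
    exact (norm_sub_le _ _).trans (add_le_add (hM i) h2)
  obtain ⟨⟨k, r⟩, -, φ, hφ, hkr⟩ :=
    (isCompact_univ.prod (isCompact_Icc (a := (0 : ℝ)) (b := B))).isSeqCompact
      (x := fun i => ((q i).2, ρ (‖σ (q i).1‖ ^ 2)))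
      (fun i => ⟨mem_univ _, (hρ.pos _).le, hB _⟩)
  have hk : Tendsto (fun i => (q (φ i)).2) atTop (𝓝 k) := (continuous_fst.tendsto _).comp hkr
  have hr : Tendsto (fun i => ρ (‖σ (q (φ i)).1‖ ^ 2)) atTop (𝓝 r) :=
    (continuous_snd.tendsto _).comp hkr
  obtain ⟨h1, h2⟩ := tendsto_of_tendsto_perturb hH hι (q := fun i => q (φ i))
    (hw.comp hφ.tendsto_atTop) hk hr (Eventually.of_forall fun i => hbd (φ i))
  have h3 : Tendsto (fun i => actionFunctional H (σ (q (φ i)).1)) atTop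
      (𝓝 (actionFunctional H (w - r • ι k))) := by
    simpa using (hc.comp hφ.tendsto_atTop).sub h2
  obtain ⟨p, ψ, hψ, hp⟩ := hσ _ _ h1 h3
  exact ⟨(p, k), φ ∘ ψ, hφ.comp hψ, hp.prodMk_nhds (hk.comp hψ.tendsto_atTop)⟩

/-- The perturbed sublevel sets lie in the sum of a weakly compact set and the compact set
`[0, B] · ι(K)`. -/
theorem weakly_precompact_perturb (hH : IsAdmissibleHamiltonian H) (hρ : IsCutoff ρ)
    [CompactSpace K] (hι : Continuous ι) (hι1 : ∀ k, ‖ι k‖ ≤ 1)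
    (hσ : ∀ A : Set (LoopHalf n), A ⊆ range σ → (∃ C : ℝ, ∀ a ∈ A, |actionFunctional H a| ≤ C) →
      IsCompact (closure (toWeakSpace ℝ (LoopHalf n) '' A)))
    (A : Set (LoopHalf n)) (hA : A ⊆ range fun q : P × K => perturb ρ σ q.1 (ι q.2))
    (hC : ∃ C : ℝ, ∀ a ∈ A, |actionFunctional H a| ≤ C) :
    IsCompact (closure (toWeakSpace ℝ (LoopHalf n) '' A)) := by
  obtain ⟨C, hC⟩ := hC
  obtain ⟨B, hB0, hB⟩ := hρ.exists_le
  obtain ⟨D, hD0, hD⟩ := hH.exists_abs_perturb_sub_le hρ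
  obtain ⟨B', hB'⟩ := hρ.exists_sq_mul_le
  let A' : Set (LoopHalf n) := σ '' {x | ∃ k, perturb ρ σ x (ι k) ∈ A}
  have hW := hσ A' (image_subset_range _ _) ⟨C + D * B', by
    rintro _ ⟨x, ⟨k, hk⟩, rfl⟩
    have h1 := hC _ hk
    have h2 := hD (σ x) (ι k) (hι1 k)
    have h3 := mul_le_mul_of_nonneg_left (hB' ‖σ x‖ (norm_nonneg _)) hD0
    have h4 := abs_sub_abs_le_abs_sub (actionFunctional H (σ x))
      (actionFunctional H (perturb ρ σ x (ι k)))
    rw [abs_sub_comm (actionFunctional H (σ x))] at h4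
    change |actionFunctional H (perturb ρ σ x (ι k)) - _| ≤ _ at h2
    linarith⟩
  let Ψ : WeakSpace ℝ (LoopHalf n) × ℝ × K → WeakSpace ℝ (LoopHalf n) :=
    fun z => z.1 + toWeakSpace ℝ (LoopHalf n) (z.2.1 • ι z.2.2)
  have hΨ : Continuous Ψ := continuous_fst.add ((toWeakSpaceCLM ℝ (LoopHalf n)).continuous.comp
    (continuous_snd.fst.smul (hι.comp continuous_snd.snd)))
  have hZ := (hW.prod ((isCompact_Icc (a := (0 : ℝ)) (b := B)).prod
    (isCompact_univ (X := K)))).image hΨ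
  refine hZ.closure_of_subset ?_
  rintro _ ⟨a, ha, rfl⟩
  obtain ⟨⟨x, k⟩, rfl⟩ := hA ha
  refine ⟨(toWeakSpace ℝ (LoopHalf n) (σ x), ρ (‖σ x‖ ^ 2), k), ⟨subset_closure
    ⟨σ x, ⟨x, ⟨k, ha⟩, rfl⟩, rfl⟩, ⟨(hρ.pos _).le, hB _⟩, mem_univ _⟩, ?_⟩
  exact (map_add (toWeakSpace ℝ (LoopHalf n)) _ _).symm

end PerturbedAxioms

/-! ### Products of lc-manifolds -/

namespace HilbertChart

variable {P : Type u} {K : Type v} (φ : HilbertChart P) (ψ : HilbertChart K)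

/-- The model of a product chart, as the product of the models. -/
noncomputable def prodL : (φ.prod ψ).Model ≃L[ℝ] φ.Model × ψ.Model :=
  WithLp.prodContinuousLinearEquiv 2 ℝ φ.Model ψ.Model

theorem prod_source : (φ.prod ψ).source = φ.source ×ˢ ψ.source := by
  change (φ.toPartialEquiv.source ×ˢ ψ.toPartialEquiv.source) ∩ _ ⁻¹' univ = _
  rw [preimage_univ, inter_univ]
  rfl

theorem prod_target : (φ.prod ψ).target = φ.prodL ψ ⁻¹' (φ.target ×ˢ ψ.target) := by
  change univ ∩ _ = _
  rw [univ_inter]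
  rfl

variable {φ}

theorem coord_mem {p : P} (hp : p ∈ φ.source) : φ.coord p ∈ φ.target :=
  φ.toPartialEquiv.map_source hp

theorem param_mem {e : φ.Model} (he : e ∈ φ.target) : φ.param e ∈ φ.source :=
  φ.toPartialEquiv.map_target he

theorem param_coord {p : P} (hp : p ∈ φ.source) : φ.param (φ.coord p) = p :=
  φ.toPartialEquiv.left_inv hp

theorem coord_param {e : φ.Model} (he : e ∈ φ.target) : φ.coord (φ.param e) = e :=
  φ.toPartialEquiv.right_inv he

end HilbertChart

theorem cube_mono (i : ℕ) {ε δ : ℝ} (h : δ ≤ ε) : cube i δ ⊆ cube i ε :=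
  fun _ ht j => ⟨(ht j).1, (ht j).2.trans_le h⟩

theorem mem_cube_add {i j : ℕ} {ε : ℝ} {t : Fin (i + j) → ℝ} :
    t ∈ cube (i + j) ε ↔ (fun a => t (Fin.castAdd j a)) ∈ cube i ε ∧
      (fun b => t (Fin.natAdd i b)) ∈ cube j ε :=
  ⟨fun h => ⟨fun a => h _, fun b => h _⟩, fun h c => by
    refine Fin.addCases (fun a => ?_) (fun b => ?_) c
    · exact h.1 a
    · exact h.2 b⟩

namespace LCStructure

variable {P : Type u} {K : Type v}

/-- An lc-chart on a smaller cube. -/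
theorem IsLCChart.restr [TopologicalSpace P] {S : LCStructure P} {φ : HilbertChart P} {i : ℕ}
    {V : Set φ.Model} {ε δ : ℝ} {f : PartialEquiv (φ.Model × (Fin i → ℝ)) P} (h : S.IsLCChart φ i V ε f)
    (hδ : 0 < δ) (hδε : δ ≤ ε) :
    S.IsLCChart φ i V δ (f.restr (univ ×ˢ cube i δ)) := by
  have hsrc : (f.restr (univ ×ˢ cube i δ)).source = V ×ˢ cube i δ := by
    rw [PartialEquiv.restr_source, h.source_eq, prod_inter_prod, inter_univ,
      inter_eq_self_of_subset_right (cube_mono i hδε)]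
  have hsub : V ×ˢ cube i δ ⊆ f.source := by
    rw [h.source_eq]
    exact prod_mono_right (cube_mono i hδε)
  have htgt : (f.restr (univ ×ˢ cube i δ)).target ⊆ f.target := inter_subset_left
  exact
    { mem_atlas := h.mem_atlas
      isOpen_base := h.isOpen_base
      base_subset := h.base_subset
      pos := hδ
      source_eq := hsrc
      isOpen_target := by
        have ho : IsOpen {x : φ.Model × (Fin i → ℝ) | ∀ j, x.2 j < δ} := by
          simp only [ofPred_forall]
          exact isOpen_iInter_of_finite fun j =>
            isOpen_lt ((continuous_apply j).comp continuous_snd) continuous_const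
        -- the lower bounds of the cube hold on all of the original source
        have he : (f.restr (univ ×ˢ cube i δ)).target =
            f.target ∩ f.symm ⁻¹' {x | ∀ j, x.2 j < δ} := by
          ext p
          refine and_congr_right fun hp => ?_
          have hp' := f.map_target hp
          rw [h.source_eq] at hp'
          exact ⟨fun hx j => (hx.2 j).2, fun hx => ⟨mem_univ _, fun j => ⟨(hp'.2 j).1, hx j⟩⟩⟩
        rw [he]
        exact h.continuousOn_symm.isOpen_inter_preimage h.isOpen_target ho
      continuousOn := hsrc ▸ h.continuousOn.mono hsub
      continuousOn_symm := h.continuousOn_symm.mono htgt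
      zero_section := h.zero_section
      stratum := fun x hx => h.stratum x hx.1
      smooth := fun ψ hψ => (h.smooth ψ hψ).mono (inter_subset_inter_left _ inter_subset_left)
      smooth_symm := fun ψ hψ => (h.smooth_symm ψ hψ).mono
        (inter_subset_inter_right _ (preimage_mono htgt)) }

theorem card_zero_append {i j : ℕ} (t : Fin (i + j) → ℝ) :
    Nat.card {c : Fin (i + j) // t c = 0} =
      Nat.card {a : Fin i // t (Fin.castAdd j a) = 0} +
      Nat.card {b : Fin j // t (Fin.natAdd i b) = 0} := by
  rw [← Nat.card_sum]
  refine Nat.card_congr (Equiv.trans (Equiv.subtypeEquiv finSumFinEquiv fun c => Iff.rfl).symm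
    (Equiv.subtypeSum (p := fun c => t (finSumFinEquiv c) = 0)))

section Product

variable (φ : HilbertChart P) (ψ : HilbertChart K) (i j : ℕ)

/-- The regrouping `(M × N) × ℝ^(i+j) ≃ (M × ℝ^i) × (N × ℝ^j)`. -/
noncomputable def regroup : ((φ.prod ψ).Model × (Fin (i + j) → ℝ)) ≃L[ℝ]
    (φ.Model × (Fin i → ℝ)) × (ψ.Model × (Fin j → ℝ)) where
  toFun x := (((φ.prodL ψ x.1).1, fun a => x.2 (Fin.castAdd j a)),
    ((φ.prodL ψ x.1).2, fun b => x.2 (Fin.natAdd i b)))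
  invFun y := ((φ.prodL ψ).symm (y.1.1, y.2.1), Fin.append y.1.2 y.2.2)
  map_add' x y := by simp [Prod.ext_iff, funext_iff]
  map_smul' c x := by simp [Prod.ext_iff, funext_iff]
  left_inv x := by
    refine Prod.ext ((φ.prodL ψ).symm_apply_apply x.1) (funext fun c => ?_)
    refine Fin.addCases (fun a => ?_) (fun b => ?_) c <;> simp
  right_inv y := by
    have h := (φ.prodL ψ).apply_symm_apply (y.1.1, y.2.1)
    refine Prod.ext (Prod.ext (congrArg Prod.fst h :) (funext fun a => ?_))
      (Prod.ext (congrArg Prod.snd h :) (funext fun b => ?_)) <;> simp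
  continuous_toFun := by
    have h1 := (φ.prodL ψ).continuous
    fun_prop
  continuous_invFun := by
    refine Continuous.prodMk ((φ.prodL ψ).symm.continuous.comp (by fun_prop)) ?_
    refine continuous_pi fun c => ?_
    refine Fin.addCases (fun a => ?_) (fun b => ?_) c
    · simp only [Fin.append_left]; fun_prop
    · simp only [Fin.append_right]; fun_prop

variable {φ ψ i j}

/-- The product of two parametrizations by a model times a cube, over the product model and the
product cube. -/
noncomputable def chartProd (f : PartialEquiv (φ.Model × (Fin i → ℝ)) P)
    (g : PartialEquiv (ψ.Model × (Fin j → ℝ)) K) :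
    PartialEquiv ((φ.prod ψ).Model × (Fin (i + j) → ℝ)) (P × K) :=
  (regroup φ ψ i j).toEquiv.toPartialEquiv.trans (f.prod g)

variable (f : PartialEquiv (φ.Model × (Fin i → ℝ)) P) (g : PartialEquiv (ψ.Model × (Fin j → ℝ)) K)

theorem chartProd_source :
    (chartProd f g).source = regroup φ ψ i j ⁻¹' (f.source ×ˢ g.source) := by
  change univ ∩ _ = _
  rw [univ_inter]
  rfl

theorem chartProd_target : (chartProd f g).target = f.target ×ˢ g.target := by
  change _ ∩ _ ⁻¹' univ = _
  rw [preimage_univ, inter_univ]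
  rfl

variable {f g} [TopologicalSpace P] [TopologicalSpace K]

theorem IsLCChart.prod {S : LCStructure P} {T : LCStructure K} {V : Set φ.Model} {W : Set ψ.Model}
    {ε : ℝ} (hf : S.IsLCChart φ i V ε f) (hg : T.IsLCChart ψ j W ε g) :
    (S.prod T).IsLCChart (φ.prod ψ) (i + j) (φ.prodL ψ ⁻¹' (V ×ˢ W)) ε (chartProd f g) where
  mem_atlas := ⟨φ, hf.mem_atlas, ψ, hg.mem_atlas, rfl⟩
  isOpen_base := (hf.isOpen_base.prod hg.isOpen_base).preimage (φ.prodL ψ).continuous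
  base_subset := by
    rw [HilbertChart.prod_target]
    exact preimage_mono (prod_mono hf.base_subset hg.base_subset)
  pos := hf.pos
  source_eq := by
    rw [chartProd_source, hf.source_eq, hg.source_eq]
    ext x
    rw [mem_prod, mem_cube_add]
    exact and_and_and_comm
  isOpen_target := by
    rw [chartProd_target]
    exact hf.isOpen_target.prod hg.isOpen_target
  continuousOn := by
    rw [chartProd_source]
    exact (hf.continuousOn.prodMap hg.continuousOn).comp (regroup φ ψ i j).continuous.continuousOn
      (mapsTo_preimage _ _)
  continuousOn_symm := by
    rw [chartProd_target]
    exact (regroup φ ψ i j).symm.continuous.comp_continuousOn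
      (hf.continuousOn_symm.prodMap hg.continuousOn_symm)
  zero_section := fun v hv => Prod.ext (hf.zero_section _ hv.1) (hg.zero_section _ hv.2)
  stratum := fun x hx => by
    rw [chartProd_source] at hx
    rw [card_zero_append]
    exact congrArg₂ (· + ·) (hf.stratum _ hx.1) (hg.stratum _ hx.2)
  smooth := by
    rintro _ ⟨φ', hφ', ψ', hψ', rfl⟩
    rw [chartProd_source, HilbertChart.prod_source]
    have hR := (regroup φ ψ i j).contDiff (n := ∞)
    have h1 := (hf.smooth φ' hφ').comp (s := regroup φ ψ i j ⁻¹' (f.source ×ˢ g.source) ∩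
      chartProd f g ⁻¹' (φ'.source ×ˢ ψ'.source)) (contDiff_fst.comp hR).contDiffOn
      fun x hx => ⟨hx.1.1, hx.2.1⟩
    have h2 := (hg.smooth ψ' hψ').comp (s := regroup φ ψ i j ⁻¹' (f.source ×ˢ g.source) ∩
      chartProd f g ⁻¹' (φ'.source ×ˢ ψ'.source)) (contDiff_snd.comp hR).contDiffOn
      fun x hx => ⟨hx.1.2, hx.2.2⟩
    exact (φ'.prodL ψ').symm.contDiff.comp_contDiffOn (h1.prodMk h2)
  smooth_symm := by
    rintro _ ⟨φ', hφ', ψ', hψ', rfl⟩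
    rw [chartProd_target, HilbertChart.prod_target]
    have hR := (φ'.prodL ψ').contDiff (n := ∞)
    have h1 := (hf.smooth_symm φ' hφ').comp (s := φ'.prodL ψ' ⁻¹' (φ'.target ×ˢ ψ'.target) ∩
      (φ'.prod ψ').param ⁻¹' (f.target ×ˢ g.target)) (contDiff_fst.comp hR).contDiffOn
      fun x hx => ⟨hx.1.1, hx.2.1⟩
    have h2 := (hg.smooth_symm ψ' hψ').comp (s := φ'.prodL ψ' ⁻¹' (φ'.target ×ˢ ψ'.target) ∩
      (φ'.prod ψ').param ⁻¹' (f.target ×ˢ g.target)) (contDiff_snd.comp hR).contDiffOn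
      fun x hx => ⟨hx.1.2, hx.2.2⟩
    exact (regroup φ ψ i j).symm.contDiff.comp_contDiffOn (h1.prodMk h2)

end Product

variable [TopologicalSpace P] [TopologicalSpace K]

theorem isClosed_le_codim_prod {S : LCStructure P} {T : LCStructure K}
    (hS : ∀ i, IsClosed {p | i ≤ S.codim p}) (hT : ∀ i, IsClosed {k | i ≤ T.codim k}) (i : ℕ) :
    IsClosed {x : P × K | i ≤ (S.prod T).codim x} := by
  have he : {x : P × K | i ≤ (S.prod T).codim x} =
      ⋃ a ∈ Finset.range (i + 1), {p | a ≤ S.codim p} ×ˢ {k | i - a ≤ T.codim k} := by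
    ext ⟨p, k⟩
    simp only [LCStructure.prod, mem_ofPred_eq, mem_iUnion, mem_prod, Finset.mem_range]
    constructor
    · intro h
      exact ⟨min (S.codim p) i, by omega, by omega, by omega⟩
    · rintro ⟨a, h1, h2, h3⟩
      omega
  rw [he]
  exact isClosed_biUnion_finset fun a _ => (hS a).prod (hT _)

theorem IsLCManifold.prod {S : LCStructure P} {T : LCStructure K} (hS : S.IsLCManifold)
    (hT : T.IsLCManifold) : (S.prod T).IsLCManifold where
  t2 := by
    have := hS.t2
    have := hT.t2
    infer_instance
  secondCountable := by
    have := hS.secondCountable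
    have := hT.secondCountable
    infer_instance
  isClosed_stratum := isClosed_le_codim_prod hS.isClosed_stratum hT.isClosed_stratum
  finite_depth := by
    obtain ⟨a, ha⟩ := hS.finite_depth
    obtain ⟨b, hb⟩ := hT.finite_depth
    exact ⟨a + b, fun x => add_le_add (ha x.1) (hb x.2)⟩
  source_open := by
    rintro _ ⟨φ, hφ, ψ, hψ, rfl⟩
    obtain ⟨i, O, hO, hφO⟩ := hS.source_open φ hφ
    obtain ⟨j, Q, hQ, hψQ⟩ := hT.source_open ψ hψ
    -- where the depths are at most `i` and `j`, total depth `i + j` fixes both of them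
    refine ⟨i + j, (O ∩ {p | i + 1 ≤ S.codim p}ᶜ) ×ˢ (Q ∩ {k | j + 1 ≤ T.codim k}ᶜ),
      (hO.inter (hS.isClosed_stratum _).isOpen_compl).prod
        (hQ.inter (hT.isClosed_stratum _).isOpen_compl), ?_⟩
    rw [HilbertChart.prod_source, hφO, hψQ]
    ext ⟨p, k⟩
    simp only [LCStructure.prod, mem_prod, mem_inter_iff, mem_ofPred_eq, mem_compl_iff]
    constructor
    · rintro ⟨⟨h1, h2⟩, h3, h4⟩
      exact ⟨⟨⟨h1, by omega⟩, h3, by omega⟩, by omega⟩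
    · rintro ⟨⟨⟨h1, h2⟩, h3, h4⟩, h5⟩
      exact ⟨⟨h1, by omega⟩, h3, by omega⟩
  target_open := by
    rintro _ ⟨φ, hφ, ψ, hψ, rfl⟩
    rw [HilbertChart.prod_target]
    exact ((hS.target_open φ hφ).prod (hT.target_open ψ hψ)).preimage (φ.prodL ψ).continuous
  continuousOn_coord := by
    rintro _ ⟨φ, hφ, ψ, hψ, rfl⟩
    rw [HilbertChart.prod_source]
    exact (φ.prodL ψ).symm.continuous.comp_continuousOn
      ((hS.continuousOn_coord φ hφ).prodMap (hT.continuousOn_coord ψ hψ))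
  continuousOn_param := by
    rintro _ ⟨φ, hφ, ψ, hψ, rfl⟩
    rw [HilbertChart.prod_target]
    exact ((hS.continuousOn_param φ hφ).prodMap (hT.continuousOn_param ψ hψ)).comp
      (φ.prodL ψ).continuous.continuousOn (mapsTo_preimage _ _)
  cover := by
    rintro ⟨p, k⟩
    obtain ⟨φ, hφ, hp⟩ := hS.cover p
    obtain ⟨ψ, hψ, hk⟩ := hT.cover k
    exact ⟨φ.prod ψ, ⟨φ, hφ, ψ, hψ, rfl⟩, by rw [HilbertChart.prod_source]; exact ⟨hp, hk⟩⟩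
  compatible := by
    rintro _ ⟨φ, hφ, ψ, hψ, rfl⟩ _ ⟨φ', hφ', ψ', hψ', rfl⟩
    rw [HilbertChart.prod_target, HilbertChart.prod_source]
    have hR := (φ.prodL ψ).contDiff (n := ∞)
    have h1 := (hS.compatible φ hφ φ' hφ').comp (s := φ.prodL ψ ⁻¹' (φ.target ×ˢ ψ.target) ∩
      (φ.prod ψ).param ⁻¹' (φ'.source ×ˢ ψ'.source)) (contDiff_fst.comp hR).contDiffOn
      fun x hx => ⟨hx.1.1, hx.2.1⟩
    have h2 := (hT.compatible ψ hψ ψ' hψ').comp (s := φ.prodL ψ ⁻¹' (φ.target ×ˢ ψ.target) ∩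
      (φ.prod ψ).param ⁻¹' (φ'.source ×ˢ ψ'.source)) (contDiff_snd.comp hR).contDiffOn
      fun x hx => ⟨hx.1.2, hx.2.2⟩
    exact (φ'.prodL ψ').symm.contDiff.comp_contDiffOn (h1.prodMk h2)
  exists_lcChart := by
    rintro ⟨p, k⟩
    obtain ⟨φ, V, ε, f, hf, hp, hpV⟩ := hS.exists_lcChart p
    obtain ⟨ψ, W, δ, g, hg, hk, hkW⟩ := hT.exists_lcChart k
    have hmin := lt_min hf.pos hg.pos
    exact ⟨φ.prod ψ, _, _, _, (hf.restr hmin (min_le_left _ _)).prod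
      (hg.restr hmin (min_le_right _ _)), by rw [HilbertChart.prod_source]; exact ⟨hp, hk⟩,
      hpV, hkW⟩

end LCStructure

/-! ### Smooth combinations of lc-smooth maps -/

namespace LCStructure

variable {P : Type u} {K : Type v}
  {B B' C : Type*} [NormedAddCommGroup B] [NormedSpace ℝ B] [NormedAddCommGroup B']
  [NormedSpace ℝ B'] [NormedAddCommGroup C] [NormedSpace ℝ C]

theorem hasFDerivAt_comp_prodL {φ : HilbertChart P} {ψ : HilbertChart K} {a : φ.Model → B}
    {b : ψ.Model → B'} {Θ : B × B' → C} (e : (φ.prod ψ).Model)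
    (ha : DifferentiableAt ℝ a (φ.prodL ψ e).1) (hb : DifferentiableAt ℝ b (φ.prodL ψ e).2)
    (hΘ : DifferentiableAt ℝ Θ (a (φ.prodL ψ e).1, b (φ.prodL ψ e).2)) :
    HasFDerivAt (fun e => Θ (a (φ.prodL ψ e).1, b (φ.prodL ψ e).2))
      (fderiv ℝ Θ (a (φ.prodL ψ e).1, b (φ.prodL ψ e).2) ∘L
        (ContinuousLinearMap.inl ℝ B B' ∘L fderiv ℝ a (φ.prodL ψ e).1 ∘L
            ContinuousLinearMap.fst ℝ φ.Model ψ.Model +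
          ContinuousLinearMap.inr ℝ B B' ∘L fderiv ℝ b (φ.prodL ψ e).2 ∘L
            ContinuousLinearMap.snd ℝ φ.Model ψ.Model) ∘L (φ.prodL ψ : _ →L[ℝ] _)) e := by
  have h := (ha.hasFDerivAt.prodMap (p := φ.prodL ψ e) (f := a) (f₂ := b) hb.hasFDerivAt)
  have h2 := (hΘ.hasFDerivAt.comp (φ.prodL ψ e) h).comp e (φ.prodL ψ).hasFDerivAt
  refine h2.congr_fderiv ?_
  exact ContinuousLinearMap.ext fun x =>
    congrArg (fderiv ℝ Θ _) (Prod.ext (by simp) (by simp))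

variable [TopologicalSpace P] [TopologicalSpace K]

/-- A smooth function of two lc-smooth maps is lc-smooth on the product. -/
theorem IsLCSmooth.comp_prod {S : LCStructure P} {T : LCStructure K} {σ : P → B} {τ : K → B'}
    (hσ : S.IsLCSmooth σ) (hτ : T.IsLCSmooth τ) {Θ : B × B' → C} (hΘ : ContDiff ℝ ∞ Θ) :
    (S.prod T).IsLCSmooth (fun q : P × K => Θ (σ q.1, τ q.2)) where
  continuous := hΘ.continuous.comp
    ((hσ.continuous.comp continuous_fst).prodMk (hτ.continuous.comp continuous_snd))
  stratum_smooth := by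
    rintro _ ⟨φ, hφ, ψ, hψ, rfl⟩
    rw [HilbertChart.prod_target]
    have hR := (φ.prodL ψ).contDiff (n := ∞)
    have h1 := (hσ.stratum_smooth φ hφ).comp (s := φ.prodL ψ ⁻¹' (φ.target ×ˢ ψ.target))
      (contDiff_fst.comp hR).contDiffOn fun x hx => hx.1
    have h2 := (hτ.stratum_smooth ψ hψ).comp (s := φ.prodL ψ ⁻¹' (φ.target ×ˢ ψ.target))
      (contDiff_snd.comp hR).contDiffOn fun x hx => hx.2
    exact hΘ.comp_contDiffOn (h1.prodMk h2)
  exists_lcChart := by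
    rintro ⟨p, k⟩
    obtain ⟨φ, V, ε, f, hf, hp, hpV, hfs, hfd⟩ := hσ.exists_lcChart p
    obtain ⟨ψ, W, δ, g, hg, hk, hkW, hgs, hgd⟩ := hτ.exists_lcChart k
    have hmin := lt_min hf.pos hg.pos
    have hf' := hf.restr hmin (min_le_left _ _)
    have hg' := hg.restr hmin (min_le_right _ _)
    refine ⟨φ.prod ψ, _, _, _, hf'.prod hg', by rw [HilbertChart.prod_source]; exact ⟨hp, hk⟩,
      ⟨hpV, hkW⟩, fun t ht => ?_, ?_⟩
    · obtain ⟨ht1, ht2⟩ := mem_cube_add.1 ht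
      have hR := (φ.prodL ψ).contDiff (n := ∞)
      have h1 := (hfs _ (cube_mono _ (min_le_left _ _) ht1)).comp (s := φ.prodL ψ ⁻¹' (V ×ˢ W))
        (contDiff_fst.comp hR).contDiffOn fun x hx => hx.1
      have h2 := (hgs _ (cube_mono _ (min_le_right _ _) ht2)).comp (s := φ.prodL ψ ⁻¹' (V ×ˢ W))
        (contDiff_snd.comp hR).contDiffOn fun x hx => hx.2
      exact hΘ.comp_contDiffOn (h1.prodMk h2)
    · set R := regroup φ ψ (S.codim p) (T.codim k)
      set Z := (φ.prodL ψ ⁻¹' (V ×ˢ W)) ×ˢ cube (S.codim p + T.codim k) (min ε δ)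
      have hm1 : MapsTo (fun x => (R x).1) Z (V ×ˢ cube (S.codim p) ε) := fun x hx =>
        ⟨hx.1.1, cube_mono _ (min_le_left _ _) (mem_cube_add.1 hx.2).1⟩
      have hm2 : MapsTo (fun x => (R x).2) Z (W ×ˢ cube (T.codim k) δ) := fun x hx =>
        ⟨hx.1.2, cube_mono _ (min_le_right _ _) (mem_cube_add.1 hx.2).2⟩
      have hR1 : ContinuousOn (fun x => (R x).1) Z := (continuous_fst.comp R.continuous).continuousOn
      have hR2 : ContinuousOn (fun x => (R x).2) Z := (continuous_snd.comp R.continuous).continuousOn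
      have hd1 := hfd.comp hR1 hm1
      have hd2 := hgd.comp hR2 hm2
      have hc1 := hσ.continuous.comp_continuousOn ((hf.source_eq ▸ hf.continuousOn).comp hR1 hm1)
      have hc2 := hτ.continuous.comp_continuousOn ((hg.source_eq ▸ hg.continuousOn).comp hR2 hm2)
      have hΘ' := (hΘ.continuous_fderiv (by simp)).comp_continuousOn (hc1.prodMk hc2)
      have hsum := (((continuousOn_const (c := ContinuousLinearMap.inl ℝ B B')).clm_comp
          (hd1.clm_comp (continuousOn_const (c := ContinuousLinearMap.fst ℝ φ.Model ψ.Model)))).add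
        ((continuousOn_const (c := ContinuousLinearMap.inr ℝ B B')).clm_comp
          (hd2.clm_comp (continuousOn_const (c := ContinuousLinearMap.snd ℝ φ.Model ψ.Model)))))
      refine (hΘ'.clm_comp (hsum.clm_comp (continuousOn_const
        (c := ((φ.prodL ψ : (φ.prod ψ).Model →L[ℝ] φ.Model × ψ.Model)))))).congr fun x hx => ?_
      have ha := ((hfs _ (hm1 hx).2).contDiffAt (hf.isOpen_base.mem_nhds (hm1 hx).1)).differentiableAt
        (by simp)
      have hb := ((hgs _ (hm2 hx).2).contDiffAt (hg.isOpen_base.mem_nhds (hm2 hx).1)).differentiableAt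
        (by simp)
      exact (hasFDerivAt_comp_prodL x.1 ha hb (hΘ.differentiable (by simp) _)).fderiv

/-- The charts of a compact lc-manifold have finite-dimensional models, since the open strata are
locally compact. -/
theorem IsLCManifold.finiteDimensional [CompactSpace K] {T : LCStructure K} (hT : T.IsLCManifold)
    {ψ : HilbertChart K} (hψ : ψ ∈ T.atlas) {k : K} (hk : k ∈ ψ.source) :
    FiniteDimensional ℝ ψ.Model := by
  have := hT.t2
  obtain ⟨i, O, hO, hOψ⟩ := hT.source_open ψ hψ
  have hk' := hk
  rw [hOψ] at hk'
  -- the stratum is closed in the open set of points of depth at most `i`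
  have hU : O ∩ {k | i + 1 ≤ T.codim k}ᶜ ∈ 𝓝 k :=
    (hO.inter (hT.isClosed_stratum _).isOpen_compl).mem_nhds
      ⟨hk'.1, fun h => by have h1 := hk'.2; simp only [mem_ofPred_eq] at h h1; omega⟩
  obtain ⟨A, hA, hAU, hAc⟩ := local_compact_nhds hU
  have hsub : A ∩ {k | i ≤ T.codim k} ⊆ ψ.source := by
    rintro x ⟨hx, hx'⟩
    have h1 := hAU hx
    rw [hOψ]
    refine ⟨h1.1, ?_⟩
    have h2 := h1.2
    simp only [mem_ofPred_eq, mem_compl_iff] at h2 hx' ⊢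
    omega
  have hcomp := (hAc.inter_right (hT.isClosed_stratum i)).image_of_continuousOn
    ((hT.continuousOn_coord ψ hψ).mono hsub)
  have hnhds : ψ.coord '' (A ∩ {k | i ≤ T.codim k}) ∈ 𝓝 (ψ.coord k) := by
    have h1 : ContinuousAt ψ.param (ψ.coord k) := (hT.continuousOn_param ψ hψ).continuousAt
      ((hT.target_open ψ hψ).mem_nhds (HilbertChart.coord_mem hk))
    have h2 : ψ.param ⁻¹' A ∈ 𝓝 (ψ.coord k) := h1 (by rwa [HilbertChart.param_coord hk])
    filter_upwards [h2, (hT.target_open ψ hψ).mem_nhds (HilbertChart.coord_mem hk)] with e he he'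
    have h3 := HilbertChart.param_mem he'
    rw [hOψ] at h3
    exact ⟨ψ.param e, ⟨he, h3.2.ge⟩, HilbertChart.coord_param he'⟩
  have := hcomp.locallyCompactSpace_of_mem_nhds_of_addGroup hnhds
  exact FiniteDimensional.of_locallyCompactSpace ℝ

end LCStructure

/-! ### Differentials of the perturbed family -/

section Differential

variable {E F B : Type*} [NormedAddCommGroup E] [NormedSpace ℝ E] [NormedAddCommGroup F]
  [NormedSpace ℝ F] [NormedAddCommGroup B] [NormedSpace ℝ B]

theorem hasFDerivAt_add_smul {s : E → B} {r : E → ℝ} {j : F → B} {e : E} {w : F}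
    {s' : E →L[ℝ] B} {r' : E →L[ℝ] ℝ} {j' : F →L[ℝ] B} (hs : HasFDerivAt s s' e)
    (hr : HasFDerivAt r r' e) (hj : HasFDerivAt j j' w) :
    HasFDerivAt (fun q : E × F => s q.1 + r q.1 • j q.2)
      ((s' + r'.smulRight (j w)) ∘L ContinuousLinearMap.fst ℝ E F +
        (r e • j') ∘L ContinuousLinearMap.snd ℝ E F) (e, w) := by
  have h1 : HasFDerivAt (fun q : E × F => s q.1) (s' ∘L ContinuousLinearMap.fst ℝ E F) (e, w) :=
    HasFDerivAt.comp (e, w) hs hasFDerivAt_fst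
  have h2 : HasFDerivAt (fun q : E × F => r q.1) (r' ∘L ContinuousLinearMap.fst ℝ E F) (e, w) :=
    HasFDerivAt.comp (e, w) hr hasFDerivAt_fst
  have h3 : HasFDerivAt (fun q : E × F => j q.2) (j' ∘L ContinuousLinearMap.snd ℝ E F) (e, w) :=
    HasFDerivAt.comp (e, w) hj hasFDerivAt_snd
  refine (h1.add (h2.smul h3)).congr_fderiv (ContinuousLinearMap.ext fun q => ?_)
  simp only [add_apply, ContinuousLinearMap.comp_apply, smul_apply,
    ContinuousLinearMap.smulRight_apply]
  abel

theorem LCStructure.IsLCSmooth.hasFDerivAt {P : Type u} [TopologicalSpace P] {S : LCStructure P}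
    {σ : P → B} (hS : S.IsLCManifold) (hσ : S.IsLCSmooth σ) {φ : HilbertChart P}
    (hφ : φ ∈ S.atlas) {x : P} (hx : x ∈ φ.source) :
    HasFDerivAt (fun e => σ (φ.param e)) (φ.D σ x) (φ.coord x) :=
  (((hσ.stratum_smooth φ hφ).contDiffAt ((hS.target_open φ hφ).mem_nhds
    (HilbertChart.coord_mem hx))).differentiableAt (by simp)).hasFDerivAt

variable {n : ℕ} {ρ : ℝ → ℝ}

theorem contDiff_perturb (hρ : IsCutoff ρ) :
    ContDiff ℝ ∞ fun z : LoopHalf n × LoopHalf n => z.1 + ρ (‖z.1‖ ^ 2) • z.2 :=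
  contDiff_fst.add ((hρ.smooth.comp ((contDiff_norm_sq ℝ).comp contDiff_fst)).smul contDiff_snd)

theorem isCompactOperator_fderiv_perturb {P : Type*} (ρ : ℝ → ℝ) (σ : P → LoopHalf n) (x : P)
    (v : LoopTwo n) :
    IsCompactOperator (fderiv ℝ (fun w : LoopTwo n => perturb ρ σ x (inclTwo n w)) v) := by
  let c := ρ (‖σ x‖ ^ 2)
  have h : HasFDerivAt (fun w => σ x + (c • inclTwo n) w) (c • inclTwo n) v :=
    (c • inclTwo n).hasFDerivAt.const_add (σ x)
  have h' : fderiv ℝ (fun w : LoopTwo n => perturb ρ σ x (inclTwo n w)) v = c • inclTwo n :=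
    h.fderiv
  rw [h']
  exact (isCompactOperator_inclTwo n).smul c

variable {P : Type u} [TopologicalSpace P] {S : LCStructure P} {σ : P → LoopHalf n}

theorem hasFDerivAt_cutoff (hρ : IsCutoff ρ) (hS : S.IsLCManifold) (hσ : S.IsLCSmooth σ)
    {φ : HilbertChart P} (hφ : φ ∈ S.atlas) {x : P} (hx : x ∈ φ.source) :
    HasFDerivAt (fun e => ρ (‖σ (φ.param e)‖ ^ 2))
      (φ.D (fun x' => ρ (‖σ x'‖ ^ 2)) x) (φ.coord x) := by
  have h1 := (hσ.hasFDerivAt hS hφ hx).differentiableAt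
  have h2 : Differentiable ℝ fun γ : LoopHalf n => ρ (‖γ‖ ^ 2) :=
    (hρ.smooth.comp (contDiff_norm_sq ℝ)).differentiable (by simp)
  exact ((h2 _).comp _ h1).hasFDerivAt

/-- The differential of `F(·, v)` is a rank one perturbation of the differential of `σ`. -/
theorem D_perturb (hρ : IsCutoff ρ) (hS : S.IsLCManifold) (hσ : S.IsLCSmooth σ)
    {φ : HilbertChart P} (hφ : φ ∈ S.atlas) {x : P} (hx : x ∈ φ.source) (v : LoopHalf n) :
    φ.D (fun x' => perturb ρ σ x' v) x =
      φ.D σ x + (φ.D (fun x' => ρ (‖σ x'‖ ^ 2)) x).smulRight v :=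
  ((hσ.hasFDerivAt hS hφ hx).add
    ((hasFDerivAt_cutoff hρ hS hσ hφ hx).smul_const v)).fderiv

theorem denseRange_fderiv_perturb (hρ : IsCutoff ρ) (hS : S.IsLCManifold) (hσ : S.IsLCSmooth σ)
    {φ : HilbertChart P} (hφ : φ ∈ S.atlas) {x : P} (hx : x ∈ φ.source) (v : LoopTwo n) :
    DenseRange (fderiv ℝ (fun q : φ.Model × LoopTwo n =>
      perturb ρ σ (φ.param q.1) (inclTwo n q.2)) (φ.coord x, v)) := by
  have h := hasFDerivAt_add_smul (hσ.hasFDerivAt hS hφ hx) (hasFDerivAt_cutoff hρ hS hσ hφ hx)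
    ((inclTwo n).hasFDerivAt (x := v))
  have h' := h.fderiv
  change DenseRange (fderiv ℝ (fun q : φ.Model × LoopTwo n =>
    σ (φ.param q.1) + ρ (‖σ (φ.param q.1)‖ ^ 2) • inclTwo n q.2) (φ.coord x, v))
  rw [h']
  have hr := (hρ.pos (‖σ (φ.param (φ.coord x))‖ ^ 2)).ne'
  have hd : DenseRange (inclTwo n) := Loop.denseRange_incl (by norm_num)
  refine hd.mono ?_
  -- the `v`-directions already reach the dense image of `L²_2`, as the cutoff is positive
  rintro _ ⟨w, rfl⟩
  refine ⟨(0, (ρ (‖σ (φ.param (φ.coord x))‖ ^ 2))⁻¹ • w), ?_⟩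
  simp [smul_smul, hr]

theorem isFredholm_projNeg_perturb {pol : Polarization (LoopHalf n)} (hρ : IsCutoff ρ)
    (hS : S.IsLCManifold) (hσ : S.IsLCSmooth σ) {φ : HilbertChart P} (hφ : φ ∈ S.atlas) {x : P}
    (hx : x ∈ φ.source) (v : LoopHalf n) (h : (pol.projNeg ∘L φ.D σ x).IsFredholm) :
    (pol.projNeg ∘L φ.D (fun x' => perturb ρ σ x' v) x).IsFredholm := by
  rw [D_perturb hρ hS hσ hφ hx, ContinuousLinearMap.comp_add]
  exact h.add_of_hasFiniteRange ((hasFiniteRange_smulRight _ v).comp_left _)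

theorem isCompactOperator_projPos_perturb {pol : Polarization (LoopHalf n)} (hρ : IsCutoff ρ)
    (hS : S.IsLCManifold) (hσ : S.IsLCSmooth σ) {φ : HilbertChart P} (hφ : φ ∈ S.atlas) {x : P}
    (hx : x ∈ φ.source) (v : LoopHalf n) (h : IsCompactOperator (pol.projPos ∘L φ.D σ x)) :
    IsCompactOperator (pol.projPos ∘L φ.D (fun x' => perturb ρ σ x' v) x) := by
  rw [D_perturb hρ hS hσ hφ hx, ContinuousLinearMap.comp_add]
  exact h.add ((hasFiniteRange_smulRight _ v).isCompactOperator.clm_comp pol.projPos)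

variable {K : Type v} [TopologicalSpace K] {T : LCStructure K} {ι : K → LoopHalf n}

/-- The differential of `(x, k) ↦ F(x, ι k)` in a product chart. -/
theorem D_prod_perturb (hρ : IsCutoff ρ) (hS : S.IsLCManifold) (hσ : S.IsLCSmooth σ)
    (hT : T.IsLCManifold) (hι : T.IsLCSmooth ι) {φ : HilbertChart P} (hφ : φ ∈ S.atlas) {x : P}
    (hx : x ∈ φ.source) {ψ : HilbertChart K} (hψ : ψ ∈ T.atlas) {k : K} (hk : k ∈ ψ.source) :
    (φ.prod ψ).D (fun q : P × K => perturb ρ σ q.1 (ι q.2)) (x, k) =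
      (φ.D (fun x' => perturb ρ σ x' (ι k)) x ∘L ContinuousLinearMap.fst ℝ φ.Model ψ.Model +
        (ρ (‖σ x‖ ^ 2) • ψ.D ι k) ∘L ContinuousLinearMap.snd ℝ φ.Model ψ.Model) ∘L
          (φ.prodL ψ : (φ.prod ψ).Model →L[ℝ] φ.Model × ψ.Model) := by
  have h := hasFDerivAt_add_smul (hσ.hasFDerivAt hS hφ hx) (hasFDerivAt_cutoff hρ hS hσ hφ hx)
    (hι.hasFDerivAt hT hψ hk)
  have he : φ.prodL ψ ((φ.prod ψ).coord (x, k)) = (φ.coord x, ψ.coord k) :=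
    (φ.prodL ψ).apply_symm_apply _
  rw [← he] at h
  have h2 := (h.comp ((φ.prod ψ).coord (x, k)) (φ.prodL ψ).hasFDerivAt).fderiv
  rw [HilbertChart.param_coord hx, HilbertChart.param_coord hk,
    ← D_perturb hρ hS hσ hφ hx (ι k)] at h2
  exact h2

/-- Along a compact, hence finite-dimensional, factor only a finite rank operator is added. -/
theorem isFredholm_projNeg_prod_perturb [CompactSpace K] {pol : Polarization (LoopHalf n)}
    (hρ : IsCutoff ρ) (hS : S.IsLCManifold) (hσ : S.IsLCSmooth σ) (hT : T.IsLCManifold)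
    (hι : T.IsLCSmooth ι) {φ : HilbertChart P} (hφ : φ ∈ S.atlas) {x : P} (hx : x ∈ φ.source)
    {ψ : HilbertChart K} (hψ : ψ ∈ T.atlas) {k : K} (hk : k ∈ ψ.source)
    (h : (pol.projNeg ∘L φ.D σ x).IsFredholm) :
    (pol.projNeg ∘L (φ.prod ψ).D (fun q : P × K => perturb ρ σ q.1 (ι q.2)) (x, k)).IsFredholm := by
  have := hT.finiteDimensional hψ hk
  rw [D_prod_perturb hρ hS hσ hT hι hφ hx hψ hk]
  exact (isFredholm_projNeg_perturb hρ hS hσ hφ hx (ι k) h).comp_prod _ (φ.prodL ψ)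

theorem isCompactOperator_projPos_prod_perturb [CompactSpace K] {pol : Polarization (LoopHalf n)}
    (hρ : IsCutoff ρ) (hS : S.IsLCManifold) (hσ : S.IsLCSmooth σ) (hT : T.IsLCManifold)
    (hι : T.IsLCSmooth ι) {φ : HilbertChart P} (hφ : φ ∈ S.atlas) {x : P} (hx : x ∈ φ.source)
    {ψ : HilbertChart K} (hψ : ψ ∈ T.atlas) {k : K} (hk : k ∈ ψ.source)
    (h : IsCompactOperator (pol.projPos ∘L φ.D σ x)) :
    IsCompactOperator
      (pol.projPos ∘L (φ.prod ψ).D (fun q : P × K => perturb ρ σ q.1 (ι q.2)) (x, k)) := by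
  have := hT.finiteDimensional hψ hk
  rw [D_prod_perturb hρ hS hσ hT hι hφ hx hψ hk]
  exact (isCompactOperator_projPos_perturb hρ hS hσ hφ hx (ι k) h).comp_prod _ (φ.prodL ψ)

end Differential

/-- The perturbed family over a compact lc-manifold of perturbations is a chain. -/
theorem isSemiInfiniteChain_perturb {n : ℕ} {H : EuclideanSpace ℂ (Fin n) → ℝ}
    (hH : IsAdmissibleHamiltonian H) {pol : Polarization (LoopHalf n)} {ρ : ℝ → ℝ}
    (hρ : IsCutoff ρ) {P : Type u} [TopologicalSpace P] {S : LCStructure P} {σ : P → LoopHalf n}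
    (hσ : IsSemiInfiniteChain S pol (actionFunctional H) σ) {K : Type v} [TopologicalSpace K]
    [CompactSpace K] {T : LCStructure K} (hT : T.IsLCManifold) {ι : K → LoopHalf n}
    (hι : T.IsLCSmooth ι) (hι1 : ∀ k, ‖ι k‖ ≤ 1) :
    IsSemiInfiniteChain (S.prod T) pol (actionFunctional H)
      (fun q : P × K => perturb ρ σ q.1 (ι q.2)) where
  isLCManifold := hσ.isLCManifold.prod hT
  isLCSmooth := hσ.isLCSmooth.comp_prod hι (contDiff_perturb hρ)
  bddBelow := bddBelow_perturb hH hρ hι1 hσ.bddBelow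
  weak_lsc := weak_lsc_perturb hH hρ hι.continuous hι1 hσ.weak_lsc
  strong_convergence := by
    have := hT.secondCountable
    exact strong_convergence_perturb hH hρ hι.continuous hι1 hσ.strong_convergence
  weakly_precompact := weakly_precompact_perturb hH hρ hι.continuous hι1 hσ.weakly_precompact
  fredholm := by
    rintro _ ⟨φ, hφ, ψ, hψ, rfl⟩ ⟨x, k⟩ hxk
    rw [HilbertChart.prod_source] at hxk
    exact isFredholm_projNeg_prod_perturb hρ hσ.isLCManifold hσ.isLCSmooth hT hι hφ hxk.1 hψ hxk.2
      (hσ.fredholm φ hφ x hxk.1)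
  compact := by
    rintro _ ⟨φ, hφ, ψ, hψ, rfl⟩ ⟨x, k⟩ hxk
    rw [HilbertChart.prod_source] at hxk
    exact isCompactOperator_projPos_prod_perturb hρ hσ.isLCManifold hσ.isLCSmooth hT hι hφ hxk.1 hψ
      hxk.2 (hσ.compact φ hφ x hxk.1)

theorem mainTheorem5 {n : ℕ}
    (H : EuclideanSpace ℂ (Fin n) → ℝ) (hH : IsAdmissibleHamiltonian H)
    (pol : Polarization (LoopHalf n))
    (hpol : pol = spectralPolarization n ∨ pol = (spectralPolarization n).swap)
    (ρ : ℝ → ℝ) (hρ : IsCutoff ρ)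
    {P : Type*} [TopologicalSpace P] (S : LCStructure P)
    (σ : P → LoopHalf n) (hσ : IsSemiInfiniteChain S pol (actionFunctional H) σ) :
    -- `F` restricts to `σ` at `v = 0`
    (∀ x, perturb ρ σ x 0 = σ x) ∧
    -- `F` is continuous, and smooth on (open stratum of `P`) × `L²_2`
    Continuous (fun q : P × LoopTwo n => perturb ρ σ q.1 (inclTwo n q.2)) ∧
    (∀ φ ∈ S.atlas,
      ContDiffOn ℝ ∞ (fun q : φ.Model × LoopTwo n => perturb ρ σ (φ.param q.1) (inclTwo n q.2))
        (φ.target ×ˢ univ)) ∧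
    -- the differentials of `F` at `(x, v)`, for `x ∈ P` and `v ∈ 𝒫`
    (∀ φ ∈ S.atlas, ∀ x ∈ φ.source, ∀ v ∈ Metric.closedBall (0 : LoopTwo n) 1,
      DenseRange (fderiv ℝ (fun q : φ.Model × LoopTwo n =>
        perturb ρ σ (φ.param q.1) (inclTwo n q.2)) (φ.coord x, v)) ∧
      (pol.projNeg ∘L φ.D (fun x' => perturb ρ σ x' (inclTwo n v)) x).IsFredholm ∧
      IsCompactOperator (pol.projPos ∘L φ.D (fun x' => perturb ρ σ x' (inclTwo n v)) x) ∧
      IsCompactOperator (fderiv ℝ (fun w : LoopTwo n => perturb ρ σ x (inclTwo n w)) v)) ∧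
    -- the restriction of `F` to `P × K` is a chain
    (∀ (K : Type*) [TopologicalSpace K] [CompactSpace K] (SK : LCStructure K),
      SK.IsLCManifold → ∀ ι : K → LoopHalf n, SK.IsLCSmooth ι → (∀ k, ι k ∈ pertBall n) →
      IsSemiInfiniteChain (S.prod SK) pol (actionFunctional H)
        (fun q : P × K => perturb ρ σ q.1 (ι q.2))) := by

  have hS := hσ.isLCManifold
  have hs := hσ.isLCSmooth
  refine ⟨fun x => by simp [perturb], ?_, fun φ hφ => ?_, fun φ hφ x hx v _ => ⟨?_, ?_, ?_, ?_⟩,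
    fun K _ _ SK hK ι hι hι1 => ?_⟩
  · exact (contDiff_perturb hρ).continuous.comp ((hs.continuous.comp continuous_fst).prodMk
      ((inclTwo n).continuous.comp continuous_snd))
  · exact (contDiff_perturb hρ).comp_contDiffOn
      (((hs.stratum_smooth φ hφ).comp contDiff_fst.contDiffOn fun q hq => hq.1).prodMk
        ((inclTwo n).contDiff.comp contDiff_snd).contDiffOn)
  · exact denseRange_fderiv_perturb hρ hS hs hφ hx v
  · exact isFredholm_projNeg_perturb hρ hS hs hφ hx _ (hσ.fredholm φ hφ x hx)
  · exact isCompactOperator_projPos_perturb hρ hS hs hφ hx _ (hσ.compact φ hφ x hx)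
  · exact isCompactOperator_fderiv_perturb ρ σ x v
  · exact isSemiInfiniteChain_perturb hH hρ hσ hK hι fun k => norm_le_one_of_mem_pertBall (hι1 k)
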